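/- Let $S^1\subset\mathbb{R}^2$ be the unit circle with its surface (arc length) measure $\sigma$, and for $f\in L^2(S^1,\sigma)$ (complex-valued) put $$\widehat{f\sigma}(\xi)=\int_{S^1}e^{-i\xi\cdot x}f(x)\,d\sigma(x),\qquad \xi\in\mathbb{R}^2.$$ For $z\in S^1$ and $r\in(0,1]$, the cap $\mathcal{C}(z,r)$ is the set of all $y\in S^1$ with $y\cdot z>0$ and $|\pi_{H_z}(y)|<r$, where $\pi_{H_z}$ is the orthogonal projection of $\mathbb{R}^2$ onto the orthogonal complement $H_z$ of $z$; write $|\mathcal{C}|=\sigma(\mathcal{C})$. Then there exist $\alpha\in(0,1)$ and a constant $C<\infty$, both independent of $f$, such that for every $f\in L^2(S^1,\sigma)$ $$\|\widehat{f\sigma}\|_{L^6(\mathbb{R}^2)}\le C\left(\sup_{\mathcal{C}}\frac{1}{|\mathcal{C}|^{1/2}}\int_{\mathcal{C}}|f|\,d\sigma\right)^{\alpha}\|f\|_{L^2(S^1,\sigma)}^{1-\alpha},$$ where the supremum is taken over all caps $\mathcal{C}=\mathcal{C}(z,r)$ with $z\in S^1$ and $r\in(0,1]$. -/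

import Mathlib

open MeasureTheory
open scoped ENNReal NNReal

noncomputable section

/-- The plane `ℝ²` with its Euclidean norm. -/
abbrev Plane : Type := EuclideanSpace ℝ (Fin 2)

/-- The unit circle `S¹ ⊂ ℝ²`. -/
abbrev UnitCircle : Type := Metric.sphere (0 : Plane) 1

/-- The surface (arc length) measure `σ` on `S¹`, of total mass `2π`. -/
def surfaceMeasure : Measure UnitCircle := (volume : Measure Plane).toSphere

/-- The Fourier transform of the measure `f σ`, that is
`ξ ↦ ∫ exp(-i ξ · x) f(x) dσ(x)`. -/
def fourierExtension (f : UnitCircle → ℂ) (ξ : Plane) : ℂ :=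
  ∫ x : UnitCircle,
    Complex.exp (-(Complex.I * ((inner ℝ ξ (x : Plane) : ℝ) : ℂ))) * f x ∂surfaceMeasure

/-- The cap with center `z` and radius `r`: the points of `S¹` in the same open hemisphere as `z`
whose orthogonal projection onto `H_z = zᗮ` has norm less than `r`. -/
def cap (z : UnitCircle) (r : ℝ) : Set UnitCircle :=
  {y | 0 < inner ℝ (y : Plane) (z : Plane) ∧
    ‖(Submodule.span ℝ {(z : Plane)})ᗮ.starProjection (y : Plane)‖ < r}

/-- The supremum over all caps `𝒞` (with centers in `S¹` and radii in `(0, 1]`) of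
`|𝒞|^{-1/2} ∫_𝒞 |f| dσ`, where `|𝒞| = σ(𝒞)`, as an extended nonnegative real. -/
def capSup (f : UnitCircle → ℂ) : ℝ≥0∞ :=
  ⨆ (z : UnitCircle) (r : ℝ) (_ : r ∈ Set.Ioc (0 : ℝ) 1),
    (surfaceMeasure (cap z r)) ^ (-(1 / 2) : ℝ) * ∫⁻ x in cap z r, ‖f x‖ₑ ∂surfaceMeasure

end

/-! Squaring turns the `L⁶` norm into an `L³` norm: the square of the transform of `fσ` is the
Fourier transform of the image of `f ⊗ f dσ dσ` under `(x, y) ↦ x + y`. In angles this map is at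
most two-to-one off antipodal pairs and has Jacobian `w = |sin (θ_y - θ_x)|`, so the image of `w dσ
dσ` is at most twice Lebesgue measure (`lintegral_circleWedge_le`). Relative to that measure the
density is `f ⊗ f / w`, and Hausdorff–Young from `L^{3/2}` to `L³` (`lintegral_fourierPush_cube_le`)
bounds the sixth power of the norm by a multiple of `(∬ |f(x)|^{3/2} |f(y)|^{3/2} w^{-1/2})²`.
Hausdorff–Young itself comes from real interpolation between the trivial `L¹ → L^∞` bound and an
`L²` bound.

The double integral is a fractional integral, singular only at `y = ±x` (`lintegral_bilinear_le`).
By symmetry one may take `|f(y)| ≤ |f(x)|`. The mass of the truncated `|f|^{3/2}` on a ball of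
radius `ρ` is then at most `8 |f(x)|^{3/2} ρ`, and by Cauchy–Schwarz at most `a³ ρ^{1/4}` with `a³ =
(16 A)^{1/2} N`, where `A` is the cap supremum and `N` the `L²` norm. Splitting at the radius where
these balance, as in Hedberg's inequality, bounds the inner integral by a multiple of `a²
|f(x)|^{1/2}` and the double integral by one of `a² N²`. Taking the sixth root gives `A^{1/9}
N^{8/9}`, so `α = 1/9`. -/

noncomputable section

/-! ### Arc length in the angle coordinate -/

/-- The identification of `ℝ × ℝ` with the Euclidean plane. -/
def prodEquivPlane : ℝ × ℝ ≃ᵐ Plane :=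
  MeasurableEquiv.finTwoArrow.symm.trans (MeasurableEquiv.toLp 2 (Fin 2 → ℝ))

@[simp]
theorem prodEquivPlane_zero (p : ℝ × ℝ) : prodEquivPlane p 0 = p.1 := rfl

@[simp]
theorem prodEquivPlane_one (p : ℝ × ℝ) : prodEquivPlane p 1 = p.2 := rfl

theorem measurePreserving_prodEquivPlane :
    MeasurePreserving prodEquivPlane (volume : Measure (ℝ × ℝ)) (volume : Measure Plane) :=
  (PiLp.volume_preserving_toLp (Fin 2)).comp ((volume_preserving_finTwoArrow ℝ).symm _)

/-- The point of the circle with angle `θ`. -/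
def circlePoint (θ : ℝ) : UnitCircle :=
  ⟨prodEquivPlane (Real.cos θ, Real.sin θ), by
    simp [EuclideanSpace.norm_eq, Fin.sum_univ_two]⟩

@[simp]
theorem circlePoint_zero (θ : ℝ) : (circlePoint θ : Plane) 0 = Real.cos θ := rfl

@[simp]
theorem circlePoint_one (θ : ℝ) : (circlePoint θ : Plane) 1 = Real.sin θ := rfl

theorem measurable_circlePoint : Measurable circlePoint := by
  apply Measurable.subtype_mk
  exact prodEquivPlane.measurable.comp (by fun_prop)

theorem UnitCircle.sq_add_sq (x : UnitCircle) : (x : Plane) 0 ^ 2 + (x : Plane) 1 ^ 2 = 1 := by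
  have h : ‖(x : Plane)‖ = 1 := by simp
  have h2 := EuclideanSpace.real_norm_sq_eq (x : Plane)
  rw [h, Fin.sum_univ_two] at h2
  linarith

theorem lintegral_Ioo_ofReal : ∫⁻ r in Set.Ioo (0 : ℝ) 1, ENNReal.ofReal r = 2⁻¹ := by
  rw [← ofReal_integral_eq_lintegral_ofReal]
  · rw [← integral_Ioc_eq_integral_Ioo, ← intervalIntegral.integral_of_le zero_le_one]
    simp
  · exact (continuous_id.integrableOn_Icc).mono_set Set.Ioo_subset_Icc_self
  · exact (ae_restrict_mem measurableSet_Ioo).mono fun r hr => hr.1.le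

open scoped Pointwise in
theorem polar_mem_cone_iff (s : Set UnitCircle) {r θ : ℝ} (hr : 0 < r) :
    prodEquivPlane (polarCoord.symm (r, θ)) ∈
      (Set.Ioo (0 : ℝ) 1 • ((↑) '' s : Set Plane)) ↔ r < 1 ∧ circlePoint θ ∈ s := by
  have key : prodEquivPlane (polarCoord.symm (r, θ)) = r • (circlePoint θ : Plane) := by
    ext i
    fin_cases i <;> simp
  rw [key]
  constructor
  · rintro ⟨t, ht, _, ⟨y, hy, rfl⟩, h⟩
    have h : t • (y : Plane) = r • (circlePoint θ : Plane) := h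
    have hn : ∀ z : UnitCircle, ‖(z : Plane)‖ = 1 := fun z => by simp
    have htr : t = r := by
      have := congrArg norm h
      rwa [norm_smul, norm_smul, hn, hn, Real.norm_of_nonneg ht.1.le, Real.norm_of_nonneg hr.le,
        mul_one, mul_one] at this
    subst htr
    have : y = circlePoint θ := Subtype.ext (smul_right_injective _ hr.ne' h)
    exact ⟨ht.2, this ▸ hy⟩
  · rintro ⟨h1, h2⟩
    exact ⟨r, ⟨hr, h1⟩, _, ⟨_, h2, rfl⟩, rfl⟩

-- In the polar decomposition of the punctured plane the cone is a product of `s` with an initial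
-- segment of radii.
open scoped Pointwise in
theorem measurableSet_cone {s : Set UnitCircle} (hs : MeasurableSet s) :
    MeasurableSet (Set.Ioo (0 : ℝ) 1 • ((↑) '' s : Set Plane)) := by
  have h : (Set.Ioo (0 : ℝ) 1 • ((↑) '' s : Set Plane)) =
      (↑) '' (homeomorphUnitSphereProd Plane ⁻¹' s ×ˢ Set.Iio ⟨1, Set.mem_Ioi.2 one_pos⟩) := by
    have hI : Set.Ioo (0 : ℝ) 1 =
        Subtype.val '' Set.Iio (⟨1, Set.mem_Ioi.2 one_pos⟩ : Set.Ioi (0 : ℝ)) :=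
      (Set.image_subtype_val_Ioi_Iio (⟨1, Set.mem_Ioi.2 one_pos⟩ : Set.Ioi (0 : ℝ))).symm
    rw [hI, ← Set.image2_smul, Set.image2_image_right, ← Homeomorph.image_symm, Set.image_image,
      Set.image2_image_left, Set.image2_swap, ← Set.image_prod]
    rfl
  rw [h]
  exact (MeasurableEmbedding.subtype_coe (measurableSet_singleton _).compl).measurableSet_image.2
    ((homeomorphUnitSphereProd Plane).measurable (hs.prod measurableSet_Iio))

-- `toSphere` is the dimension times the area of the cone; in polar coordinates that area is `∫₀¹ r
-- dr = 1/2` times the length of the set of angles, and the dimension 2 cancels the half.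
open scoped Pointwise in
theorem surfaceMeasure_eq_map :
    surfaceMeasure = (volume.restrict (Set.Ioo (-Real.pi) Real.pi)).map circlePoint := by
  ext s hs
  rw [surfaceMeasure, Measure.toSphere_apply' _ hs, Measure.map_apply measurable_circlePoint hs,
    ← measurePreserving_prodEquivPlane.measure_preimage_equiv]
  set A : Set (ℝ × ℝ) := prodEquivPlane ⁻¹' (Set.Ioo (0 : ℝ) 1 • ((↑) '' s : Set Plane)) with hA
  have hpre : MeasurableSet (circlePoint ⁻¹' s) := measurable_circlePoint hs
  have hcone : ∫⁻ p in polarCoord.target, ENNReal.ofReal p.1 • A.indicator 1 (polarCoord.symm p)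
      = ∫⁻ p in Set.Ioo (0 : ℝ) 1 ×ˢ (circlePoint ⁻¹' s ∩ Set.Ioo (-Real.pi) Real.pi),
        ENNReal.ofReal p.1 := by
    rw [← lintegral_indicator polarCoord.open_target.measurableSet,
      ← lintegral_indicator (measurableSet_Ioo.prod (hpre.inter measurableSet_Ioo))]
    congr 1
    ext ⟨r, θ⟩
    by_cases h : (r, θ) ∈ polarCoord.target
    · have h' : 0 < r ∧ θ ∈ Set.Ioo (-Real.pi) Real.pi := by
        simpa [polarCoord] using h
      have h3 : polarCoord.symm (r, θ) ∈ A ↔ _ := polar_mem_cone_iff s h'.1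
      simp only [Set.indicator_of_mem h]
      by_cases h4 : r < 1 ∧ circlePoint θ ∈ s
      · rw [Set.indicator_of_mem (h3.2 h4), Set.indicator_of_mem]
        · simp
        · exact ⟨⟨h'.1, h4.1⟩, h4.2, h'.2⟩
      · rw [Set.indicator_of_notMem (fun h => h4 (h3.1 h)), Set.indicator_of_notMem]
        · simp
        · exact fun h => h4 ⟨h.1.2, h.2.1⟩
    · rw [Set.indicator_of_notMem h, Set.indicator_of_notMem]
      intro h5
      apply h
      have : 0 < r ∧ θ ∈ Set.Ioo (-Real.pi) Real.pi := ⟨h5.1.1, h5.2.2⟩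
      simpa [polarCoord] using this
  have hAm : MeasurableSet A :=
    prodEquivPlane.measurable (measurableSet_cone hs)
  rw [lintegral_comp_polarCoord_symm, lintegral_indicator_one hAm] at hcone
  rw [hcone, Measure.volume_eq_prod, ← Measure.prod_restrict,
    lintegral_prod _ (by fun_prop)]
  simp only [lintegral_const, Measure.restrict_apply MeasurableSet.univ, Set.univ_inter]
  rw [lintegral_mul_const _ (by fun_prop), lintegral_Ioo_ofReal, Measure.restrict_apply hpre,
    ← mul_assoc]
  simp [ENNReal.mul_inv_cancel]

theorem measurePreserving_circlePoint : MeasurePreserving circlePoint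
    (volume.restrict (Set.Ioo (-Real.pi) Real.pi)) surfaceMeasure :=
  ⟨measurable_circlePoint, surfaceMeasure_eq_map.symm⟩

instance : IsFiniteMeasure surfaceMeasure := by
  unfold surfaceMeasure; infer_instance

/-! ### The wedge and its zeros -/

/-- The area of the parallelogram spanned by two points of the circle. -/
def circleWedge (x y : UnitCircle) : ℝ :=
  |(x : Plane) 0 * (y : Plane) 1 - (x : Plane) 1 * (y : Plane) 0|

theorem circleWedge_nonneg (x y : UnitCircle) : 0 ≤ circleWedge x y := abs_nonneg _

theorem dist_sq_eq (x y : UnitCircle) :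
    dist x y ^ 2 = 2 - 2 * ((x : Plane) 0 * (y : Plane) 0 + (x : Plane) 1 * (y : Plane) 1) := by
  rw [Subtype.dist_eq, EuclideanSpace.dist_sq_eq, Fin.sum_univ_two, Real.dist_eq, Real.dist_eq,
    sq_abs, sq_abs]
  linarith [x.sq_add_sq, y.sq_add_sq]

/-- This is the double angle formula: at angle `θ` the distances from `y` to `x` and `-x` are `2|sin
(θ/2)|` and `2|cos (θ/2)|`. -/
theorem circleWedge_sq (x y : UnitCircle) :
    circleWedge x y ^ 2 = (dist x y * dist (-x) y / 2) ^ 2 := by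
  rw [div_pow, mul_pow, dist_sq_eq, dist_sq_eq, circleWedge, sq_abs]
  simp only [coe_neg_sphere, PiLp.neg_apply]
  linear_combination ((y : Plane) 0 ^ 2 + (y : Plane) 1 ^ 2) * x.sq_add_sq + y.sq_add_sq

theorem circleWedge_eq (x y : UnitCircle) : circleWedge x y = dist x y * dist (-x) y / 2 :=
  (sq_eq_sq₀ (circleWedge_nonneg x y) (by positivity)).1 (circleWedge_sq x y)

/-- The squared distances to `x` and `-x` add up to 4, so the larger distance is at least 1 and can
be dropped from the product. -/
theorem min_dist_le_two_mul_circleWedge (x y : UnitCircle) :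
    min (dist x y) (dist (-x) y) ≤ 2 * circleWedge x y := by
  have h1 := dist_sq_eq x y
  have h2 := dist_sq_eq (-x) y
  simp only [coe_neg_sphere, PiLp.neg_apply] at h2
  have h3 : dist x y ^ 2 + dist (-x) y ^ 2 = 4 := by linarith
  rw [circleWedge_eq]
  have := dist_nonneg (x := x) (y := y)
  have := dist_nonneg (x := -x) (y := y)
  rcases le_total (dist x y) (dist (-x) y) with h | h
  · rw [min_eq_left h]
    nlinarith
  · rw [min_eq_right h]
    nlinarith

theorem circleWedge_comm (x y : UnitCircle) : circleWedge x y = circleWedge y x := by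
  rw [circleWedge, circleWedge, abs_sub_comm]
  ring_nf

theorem continuous_circleWedge : Continuous fun p : UnitCircle × UnitCircle => circleWedge p.1 p.2 := by
  unfold circleWedge
  fun_prop

theorem circleWedge_circlePoint (a b : ℝ) :
    circleWedge (circlePoint a) (circlePoint b) = |Real.sin (b - a)| := by
  simp only [circleWedge, circlePoint_zero, circlePoint_one, Real.sin_sub]
  ring_nf

open scoped Pointwise in
/-- Arc length of a disc intersected with the circle is at most linear in the radius. -/
theorem surfaceMeasure_ball_le (x : UnitCircle) (ρ : ℝ) :
    surfaceMeasure (Metric.ball x ρ) ≤ ENNReal.ofReal (8 * ρ) := by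
  rcases le_or_gt ρ 0 with hρ | hρ
  · simp [Metric.ball_eq_empty.2 hρ]
  -- `M` is the rotation taking `x` to the first basis vector. It sends the cone over the ball into
  -- `[-1, 1] × [-ρ, ρ]`, of area `4ρ`; the dimension factor in `toSphere` doubles this.
  set M : Matrix (Fin 2) (Fin 2) ℝ :=
    !![(x : Plane) 0, (x : Plane) 1; -(x : Plane) 1, (x : Plane) 0] with hM
  have hdet : M.det = 1 := by
    rw [hM, Matrix.det_fin_two_of]
    linarith [x.sq_add_sq]
  set B : Set (Fin 2 → ℝ) := Set.Icc ![-1, -ρ] ![1, ρ] with hB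
  have hsub : WithLp.toLp 2 ⁻¹' (Set.Ioo (0 : ℝ) 1 • ((↑) '' Metric.ball x ρ : Set Plane)) ⊆
      Matrix.toLin' M ⁻¹' B := by
    rintro v ⟨t, ht, _, ⟨y, hy, rfl⟩, h⟩
    have h0 : v 0 = t * (y : Plane) 0 := congrArg (fun w : Plane => w 0) h.symm
    have h1 : v 1 = t * (y : Plane) 1 := congrArg (fun w : Plane => w 1) h.symm
    have hd := dist_sq_eq y x
    have hy' : dist y x < ρ := hy
    have hx := x.sq_add_sq
    have hyy := y.sq_add_sq
    set a := (x : Plane) 0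
    set b := (x : Plane) 1
    set c := (y : Plane) 0
    set d := (y : Plane) 1
    have hdot : |a * c + b * d| ≤ 1 := by
      rw [abs_le]
      constructor <;> nlinarith [sq_nonneg (a + c), sq_nonneg (b + d), sq_nonneg (a - c),
        sq_nonneg (b - d)]
    have hw : |a * d - b * c| ≤ ρ := by
      apply abs_le_of_sq_le_sq _ hρ.le
      have : dist y x ^ 2 ≤ ρ ^ 2 := by gcongr
      have : (a * d - b * c) ^ 2 + (a * c + b * d) ^ 2 = 1 := by
        linear_combination (c ^ 2 + d ^ 2) * hx + hyy
      nlinarith [sq_nonneg (a * c + b * d - 1)]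
    have e0 : Matrix.toLin' M v 0 = t * (a * c + b * d) := by
      simp [hM, h0, h1, Matrix.mulVec, dotProduct]
      ring
    have e1 : Matrix.toLin' M v 1 = t * (a * d - b * c) := by
      simp [hM, h0, h1, Matrix.mulVec, dotProduct]
      ring
    have f0 : |Matrix.toLin' M v 0| ≤ 1 := by
      rw [e0, abs_mul, abs_of_pos ht.1]
      nlinarith [ht.1, ht.2, abs_nonneg (a * c + b * d)]
    have f1 : |Matrix.toLin' M v 1| ≤ ρ := by
      rw [e1, abs_mul, abs_of_pos ht.1]
      nlinarith [ht.1, ht.2, abs_nonneg (a * d - b * c)]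
    rw [abs_le] at f0 f1
    simp only [Set.mem_preimage, hB, Set.mem_Icc, Pi.le_def, Fin.forall_fin_two]
    exact ⟨⟨f0.1, f1.1⟩, f0.2, f1.2⟩
  rw [surfaceMeasure, Measure.toSphere_apply' _ Metric.isOpen_ball.measurableSet,
    ← (PiLp.volume_preserving_toLp (Fin 2)).measure_preimage
      (measurableSet_cone Metric.isOpen_ball.measurableSet).nullMeasurableSet]
  have hvol : volume (Matrix.toLin' M ⁻¹' B) = ENNReal.ofReal (4 * ρ) := by
    rw [Measure.addHaar_preimage_linearMap _ (by simp [hdet]), LinearMap.det_toLin', hdet, hB,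
      Real.volume_Icc_pi]
    simp only [Fin.prod_univ_two, Matrix.cons_val_zero, Matrix.cons_val_one]
    rw [inv_one, abs_one, ENNReal.ofReal_one, one_mul, ← ENNReal.ofReal_mul (by norm_num)]
    congr 1
    ring
  calc _ ≤ (Module.finrank ℝ Plane : ℝ≥0∞) * ENNReal.ofReal (4 * ρ) := by
        gcongr
        exact (measure_mono hsub).trans hvol.le
    _ = _ := by
        simp only [finrank_euclideanSpace, Fintype.card_fin]
        rw [show 8 * ρ = 2 * (4 * ρ) by ring, ENNReal.ofReal_mul zero_le_two]
        simp

/-! ### Change of variables for the sum of two circle points -/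

theorem angle_eq_of_cos_eq_of_sin_eq {a b : ℝ} (h : |a - b| < 2 * Real.pi)
    (hc : Real.cos a = Real.cos b) (hs : Real.sin a = Real.sin b) : a = b := by
  have : Real.cos (a - b) = 1 := by
    rw [Real.cos_sub, hc, hs]
    nlinarith [Real.sin_sq_add_cos_sq b]
  rw [abs_lt] at h
  linarith [(Real.cos_eq_one_iff_of_lt_of_lt (by linarith) h.2).1 this]

/-- The sum of the two points of the circle with given angles. -/
def angleSum (p : ℝ × ℝ) : ℝ × ℝ :=
  (Real.cos p.1 + Real.cos p.2, Real.sin p.1 + Real.sin p.2)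

/-- Pairs of increasing angles of points that are not antipodal. -/
def orderedAngles : Set (ℝ × ℝ) :=
  {p | -Real.pi < p.1 ∧ p.1 < p.2 ∧ p.2 < Real.pi ∧ p.2 - p.1 ≠ Real.pi}

theorem measurableSet_orderedAngles : MeasurableSet orderedAngles := by
  have h : orderedAngles = {p : ℝ × ℝ | -Real.pi < p.1} ∩ {p | p.1 < p.2} ∩
      {p | p.2 < Real.pi} ∩ {p | p.2 - p.1 = Real.pi}ᶜ := by
    ext p
    simp [orderedAngles, and_assoc]
  rw [h]
  exact (((measurableSet_lt (by fun_prop) (by fun_prop)).inter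
    (measurableSet_lt (by fun_prop) (by fun_prop))).inter
    (measurableSet_lt (by fun_prop) (by fun_prop))).inter
    (measurableSet_eq_fun (by fun_prop) (by fun_prop)).compl

/-- Two pairs of unit vectors with the same nonzero sum coincide up to order. -/
theorem unit_pair_eq_or_eq {a b c d e f g h : ℝ} (h1 : a ^ 2 + b ^ 2 = 1) (h2 : c ^ 2 + d ^ 2 = 1)
    (h3 : e ^ 2 + f ^ 2 = 1) (h4 : g ^ 2 + h ^ 2 = 1) (hx : a + c = e + g) (hy : b + d = f + h)
    (hne : (a + c) ^ 2 + (b + d) ^ 2 ≠ 0) : (e = a ∧ f = b) ∨ (e = c ∧ f = d) := by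
  obtain rfl : g = a + c - e := by linarith
  obtain rfl : h = b + d - f := by linarith
  set p := a + c with hp
  set q := b + d with hq
  have d1 : 2 * (a * p + b * q) = p ^ 2 + q ^ 2 := by
    rw [hp, hq]
    linear_combination h1 - h2
  have d2 : 2 * (c * p + d * q) = p ^ 2 + q ^ 2 := by
    rw [hp, hq]
    linear_combination h2 - h1
  have d3 : 2 * (e * p + f * q) = p ^ 2 + q ^ 2 := by linear_combination h3 - h4
  have w2 : c * q - d * p = -(a * q - b * p) := by rw [hp, hq]; ring
  have key : (e * q - f * p - (a * q - b * p)) * (e * q - f * p + (a * q - b * p)) = 0 := by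
    have i1 : (a * q - b * p) ^ 2 = (p ^ 2 + q ^ 2) - (a * p + b * q) ^ 2 := by
      linear_combination (p ^ 2 + q ^ 2) * h1
    have i3 : (e * q - f * p) ^ 2 = (p ^ 2 + q ^ 2) - (e * p + f * q) ^ 2 := by
      linear_combination (p ^ 2 + q ^ 2) * h3
    have : e * p + f * q = a * p + b * q := by linarith
    rw [this] at i3
    linear_combination i3 - i1
  rcases mul_eq_zero.1 key with hk | hk
  · left
    constructor <;> apply mul_left_cancel₀ hne
    · linear_combination p * (d3 - d1) / 2 + q * hk
    · linear_combination q * (d3 - d1) / 2 - p * hk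
  · right
    constructor <;> apply mul_left_cancel₀ hne
    · linear_combination p * (d3 - d2) / 2 + q * (hk - w2)
    · linear_combination q * (d3 - d2) / 2 - p * (hk - w2)

/-- A nonzero sum determines the unordered pair of unit vectors, and the ordering of the angles
removes the remaining swap. Excluding antipodal pairs keeps the sum nonzero. -/
theorem injOn_angleSum : Set.InjOn angleSum orderedAngles := by
  rintro ⟨a, b⟩ ⟨ha, hab, hb, hne⟩ ⟨c, d⟩ ⟨hc, hcd, hd, -⟩ h
  simp only at ha hab hb hne hc hcd hd
  simp only [angleSum, Prod.mk.injEq] at h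
  have hP : (Real.cos a + Real.cos b) ^ 2 + (Real.sin a + Real.sin b) ^ 2 ≠ 0 := by
    intro h0
    have h1 : Real.cos a + Real.cos b = 0 := by nlinarith
    have h2 : Real.sin a + Real.sin b = 0 := by nlinarith
    apply hne
    have : b = a + Real.pi := by
      apply angle_eq_of_cos_eq_of_sin_eq
      · rw [abs_lt]; constructor <;> linarith
      · rw [Real.cos_add_pi]; linarith
      · rw [Real.sin_add_pi]; linarith
    linarith
  have bound : ∀ {s t : ℝ}, -Real.pi < s → s < Real.pi → -Real.pi < t → t < Real.pi →
      |s - t| < 2 * Real.pi := by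
    intro s t _ _ _ _
    rw [abs_lt]; constructor <;> linarith
  rcases unit_pair_eq_or_eq (Real.cos_sq_add_sin_sq a) (Real.cos_sq_add_sin_sq b)
    (Real.cos_sq_add_sin_sq c) (Real.cos_sq_add_sin_sq d) h.1 h.2 hP with ⟨h1, h2⟩ | ⟨h1, h2⟩
  · have e1 : c = a := angle_eq_of_cos_eq_of_sin_eq (bound hc (by linarith) ha (by linarith)) h1 h2
    have e2 : d = b := angle_eq_of_cos_eq_of_sin_eq
      (bound (by linarith) hd (by linarith) hb) (by linarith) (by linarith)
    rw [e1, e2]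
  · have e1 : c = b := angle_eq_of_cos_eq_of_sin_eq (bound hc (by linarith) (by linarith) hb) h1 h2
    have e2 : d = a := angle_eq_of_cos_eq_of_sin_eq
      (bound (by linarith) hd ha (by linarith)) (by linarith) (by linarith)
    linarith

theorem hasFDerivAt_angleSum (p : ℝ × ℝ) :
    HasFDerivAt angleSum (LinearMap.toContinuousLinearMap (Matrix.toLin (Module.Basis.finTwoProd ℝ)
      (Module.Basis.finTwoProd ℝ)
      !![-Real.sin p.1, -Real.sin p.2; Real.cos p.1, Real.cos p.2])) p := by
  rw [Matrix.toLin_finTwoProd_toContinuousLinearMap]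
  convert! HasFDerivAt.prodMk (𝕜 := ℝ)
    (((Real.hasDerivAt_cos p.1).comp_hasFDerivAt p hasFDerivAt_fst).add
      ((Real.hasDerivAt_cos p.2).comp_hasFDerivAt p hasFDerivAt_snd))
    (((Real.hasDerivAt_sin p.1).comp_hasFDerivAt p hasFDerivAt_fst).add
      ((Real.hasDerivAt_sin p.2).comp_hasFDerivAt p hasFDerivAt_snd)) using 2

/-- The Jacobian determinant of `angleSum` is `sin (p.2 - p.1)`, so injectivity gives equality with
the integral over the image. -/
theorem lintegral_orderedAngles_le (φ : ℝ × ℝ → ℝ≥0∞) :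
    ∫⁻ p in orderedAngles, ENNReal.ofReal |Real.sin (p.2 - p.1)| * φ (angleSum p) ≤ ∫⁻ v, φ v := by
  have h := lintegral_image_eq_lintegral_abs_det_fderiv_mul volume measurableSet_orderedAngles
    (fun p _ => (hasFDerivAt_angleSum p).hasFDerivWithinAt) injOn_angleSum φ
  calc _ = ∫⁻ v in angleSum '' orderedAngles, φ v := by
        rw [h]
        congr! 5 with p
        simp only [LinearMap.det_toContinuousLinearMap, LinearMap.det_toLin, Matrix.det_fin_two_of,
          Real.sin_sub]
        ring
    _ ≤ _ := setLIntegral_le_lintegral _ _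

theorem lintegral_angles_le {φ : ℝ × ℝ → ℝ≥0∞} (hφ : Measurable φ) :
    ∫⁻ p in Set.Ioo (-Real.pi) Real.pi ×ˢ Set.Ioo (-Real.pi) Real.pi,
      ENNReal.ofReal |Real.sin (p.2 - p.1)| * φ (angleSum p) ≤ 2 * ∫⁻ v, φ v := by
  set G : ℝ × ℝ → ℝ≥0∞ := fun p => ENNReal.ofReal |Real.sin (p.2 - p.1)| * φ (angleSum p) with hG
  have hGm : Measurable G := by
    have : Measurable angleSum := by unfold angleSum; fun_prop
    fun_prop
  have hsymm : ∀ p, G p.swap = G p := by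
    intro p
    simp only [hG, angleSum, Prod.fst_swap, Prod.snd_swap]
    rw [← abs_neg, ← Real.sin_neg, neg_sub, add_comm (Real.cos p.2), add_comm (Real.sin p.2)]
  have hle : ∀ p, (Set.Ioo (-Real.pi) Real.pi ×ˢ Set.Ioo (-Real.pi) Real.pi).indicator G p ≤
      orderedAngles.indicator G p + orderedAngles.indicator G p.swap := by
    intro p
    by_cases hp : p ∈ Set.Ioo (-Real.pi) Real.pi ×ˢ Set.Ioo (-Real.pi) Real.pi
    · rw [Set.indicator_of_mem hp]
      obtain ⟨⟨h1, h2⟩, h3, h4⟩ := hp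
      by_cases h5 : p ∈ orderedAngles
      · rw [Set.indicator_of_mem h5]; exact le_self_add
      by_cases h6 : p.swap ∈ orderedAngles
      · rw [Set.indicator_of_mem h6, hsymm]; exact le_add_self
      -- Outside `orderedAngles` and its reflection the angles differ by `0` or `±π`, where the
      -- weight vanishes; no null-set argument is needed.
      have hz : Real.sin (p.2 - p.1) = 0 := by
        rcases lt_trichotomy p.1 p.2 with h | h | h
        · have : p.2 - p.1 = Real.pi := by
            by_contra hh; exact h5 ⟨h1, h, h4, hh⟩
          rw [this, Real.sin_pi]
        · rw [h, sub_self, Real.sin_zero]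
        · have : p.1 - p.2 = Real.pi := by
            by_contra hh; exact h6 ⟨h3, h, h2, hh⟩
          rw [← neg_sub, this, Real.sin_neg, Real.sin_pi, neg_zero]
      simp [hG, hz]
    · simp [Set.indicator_of_notMem hp]
  have hint : ∫⁻ p, orderedAngles.indicator G p ≤ ∫⁻ v, φ v := by
    rw [lintegral_indicator measurableSet_orderedAngles]
    exact lintegral_orderedAngles_le φ
  have hmeas : Measurable (orderedAngles.indicator G) := hGm.indicator measurableSet_orderedAngles
  rw [← lintegral_indicator (measurableSet_Ioo.prod measurableSet_Ioo)]
  calc _ ≤ ∫⁻ p : ℝ × ℝ, (orderedAngles.indicator G p + orderedAngles.indicator G p.swap) :=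
        lintegral_mono hle
    _ = (∫⁻ p, orderedAngles.indicator G p) + ∫⁻ p : ℝ × ℝ, orderedAngles.indicator G p.swap :=
        lintegral_add_left hmeas _
    _ = 2 * ∫⁻ p, orderedAngles.indicator G p := by
        rw [two_mul]
        congr 1
        exact (Measure.measurePreserving_swap (μ := (volume : Measure ℝ))
          (ν := (volume : Measure ℝ))).lintegral_comp hmeas
    _ ≤ _ := by gcongr

/-- The image of `w(x, y) dσ(x) dσ(y)` under addition is bounded by twice Lebesgue measure. -/
theorem lintegral_circleWedge_le {φ : Plane → ℝ≥0∞} (hφ : Measurable φ) :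
    ∫⁻ p : UnitCircle × UnitCircle, ENNReal.ofReal (circleWedge p.1 p.2) * φ (p.1 + p.2)
      ∂(surfaceMeasure.prod surfaceMeasure) ≤ 2 * ∫⁻ v, φ v := by
  have hm : Measurable fun p : UnitCircle × UnitCircle =>
      ENNReal.ofReal (circleWedge p.1 p.2) * φ (p.1 + p.2) := by
    have := continuous_circleWedge.measurable
    fun_prop
  rw [← (measurePreserving_circlePoint.prod measurePreserving_circlePoint).lintegral_comp hm,
    Measure.prod_restrict]
  have h := lintegral_angles_le (hφ.comp prodEquivPlane.measurable)
  rw [← measurePreserving_prodEquivPlane.lintegral_comp hφ]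
  refine le_trans (le_of_eq ?_) h
  congr 1
  ext p
  simp only [Prod.map_fst, Prod.map_snd, circleWedge_circlePoint, Function.comp_apply]
  congr 2
  ext i
  fin_cases i <;> simp [angleSum]

/-! ### Fourier transforms of image measures: the `L²` bound -/

/-- The Fourier transform of the image of the measure `g μ` under `Φ`. -/
def fourierPush {X : Type*} [MeasurableSpace X] (μ : Measure X) (Φ : X → Plane) (g : X → ℂ)
    (ξ : Plane) : ℂ :=
  ∫ p, Complex.exp (-(Complex.I * ((inner ℝ ξ (Φ p) : ℝ) : ℂ))) * g p ∂μ

theorem norm_exp_neg_I_mul (t : ℝ) : ‖Complex.exp (-(Complex.I * (t : ℂ)))‖ = 1 := by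
  rw [Complex.norm_exp]
  simp

theorem lintegral_gaussian {b : ℝ} (hb : 0 < b) :
    ∫⁻ v : Plane, ENNReal.ofReal (Real.exp (-b * ‖v‖ ^ 2)) = ENNReal.ofReal (Real.pi / b) := by
  have h := GaussianFourier.integral_rexp_neg_mul_sq_norm (V := Plane) hb
  have hr : (Real.pi / b) ^ ((Module.finrank ℝ Plane : ℝ) / 2) = Real.pi / b := by simp
  rw [hr] at h
  have hne : ∫ v : Plane, Real.exp (-b * ‖v‖ ^ 2) ≠ 0 := by
    rw [h]; positivity
  rw [← ofReal_integral_eq_lintegral_ofReal (Integrable.of_integral_ne_zero hne)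
    (Filter.Eventually.of_forall fun v => (Real.exp_pos _).le), h]

theorem integral_gaussian_mul_exp {b : ℝ} (hb : 0 < b) (w : Plane) :
    ∫ ξ : Plane, Complex.exp (-(b : ℂ) * (‖ξ‖ : ℂ) ^ 2) *
      Complex.exp (-(Complex.I * ((inner ℝ ξ w : ℝ) : ℂ))) =
      ((Real.pi / b * Real.exp (-(1 / (4 * b)) * ‖w‖ ^ 2) : ℝ) : ℂ) := by
  have h := GaussianFourier.integral_cexp_neg_mul_sq_norm_add (V := Plane) (b := (b : ℂ))
    (by simpa using hb) (-Complex.I) w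
  have hr : ((Real.pi : ℂ) / b) ^ ((Module.finrank ℝ Plane : ℂ) / 2) = Real.pi / b := by simp
  rw [hr] at h
  push_cast
  convert h using 2
  · ext ξ
    rw [← Complex.exp_add, real_inner_comm]
    congr 1
    ring
  · congr 1
    simp only [neg_sq, Complex.I_sq]
    have : (b : ℂ) ≠ 0 := by exact_mod_cast hb.ne'
    field_simp

section

variable {X : Type*} [MeasurableSpace X] {μ : Measure X} {Φ : X → Plane}
  {g : X → ℂ}

/-- The `L¹ → L^∞` endpoint of the interpolation. -/
theorem enorm_fourierPush_le (ξ : Plane) : ‖fourierPush μ Φ g ξ‖ₑ ≤ ∫⁻ p, ‖g p‖ₑ ∂μ := by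
  refine (enorm_integral_le_lintegral_enorm _).trans (le_of_eq ?_)
  congr 1
  ext p
  rw [enorm_mul, ← ofReal_norm, norm_exp_neg_I_mul]
  simp

theorem integrable_fourierPush (hΦ : Measurable Φ) (hg : Integrable g μ) (ξ : Plane) :
    Integrable (fun p => Complex.exp (-(Complex.I * ((inner ℝ ξ (Φ p) : ℝ) : ℂ))) * g p) μ := by
  have : Measurable fun p => inner ℝ ξ (Φ p) := measurable_const.inner hΦ
  refine hg.bdd_mul (c := 1) (by fun_prop) (Filter.Eventually.of_forall fun p => ?_)
  rw [norm_exp_neg_I_mul]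

theorem fourierPush_add (hΦ : Measurable Φ) {g₁ g₂ : X → ℂ} (h₁ : Integrable g₁ μ)
    (h₂ : Integrable g₂ μ) (ξ : Plane) :
    fourierPush μ Φ (g₁ + g₂) ξ = fourierPush μ Φ g₁ ξ + fourierPush μ Φ g₂ ξ := by
  unfold fourierPush
  rw [← integral_add (integrable_fourierPush hΦ h₁ ξ) (integrable_fourierPush hΦ h₂ ξ)]
  simp only [Pi.add_apply, mul_add]

variable [IsFiniteMeasure μ]

theorem measurable_fourierPush (hΦ : Measurable Φ) (hg : Measurable g) :
    Measurable (fourierPush μ Φ g) := by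
  have : StronglyMeasurable (Function.uncurry fun (ξ : Plane) (p : X) =>
      Complex.exp (-(Complex.I * ((inner ℝ ξ (Φ p) : ℝ) : ℂ))) * g p) := by
    apply Measurable.stronglyMeasurable
    unfold Function.uncurry
    have : Measurable fun q : Plane × X => inner ℝ q.1 (Φ q.2) :=
      measurable_fst.inner (hΦ.comp measurable_snd)
    fun_prop
  exact this.integral_prod_right.measurable

/-- The Gaussian weight makes Fubini legitimate: expand the squared modulus as a double integral and
integrate in `ξ` first, which leaves a Gaussian kernel in `Φ q.1 - Φ q.2`. -/
theorem integral_gaussian_mul_fourierPush (hΦ : Measurable Φ) (hg : Measurable g)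
    (hi : Integrable g μ) {b : ℝ} (hb : 0 < b) :
    ∫ ξ : Plane, Complex.exp (-(b : ℂ) * (‖ξ‖ : ℂ) ^ 2) *
        (fourierPush μ Φ g ξ * star (fourierPush μ Φ g ξ)) =
      ∫ q : X × X, g q.1 * star (g q.2) *
        ((Real.pi / b * Real.exp (-(1 / (4 * b)) * ‖Φ q.1 - Φ q.2‖ ^ 2) : ℝ) : ℂ) ∂(μ.prod μ) := by
  have hexp : ∀ (ξ : Plane) (q : X × X),
      Complex.exp (-(Complex.I * ((inner ℝ ξ (Φ q.1) : ℝ) : ℂ))) * g q.1 *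
        star (Complex.exp (-(Complex.I * ((inner ℝ ξ (Φ q.2) : ℝ) : ℂ))) * g q.2) =
      g q.1 * star (g q.2) *
        Complex.exp (-(Complex.I * ((inner ℝ ξ (Φ q.1 - Φ q.2) : ℝ) : ℂ))) := by
    intro ξ q
    rw [star_mul', inner_sub_right]
    have : star (Complex.exp (-(Complex.I * ((inner ℝ ξ (Φ q.2) : ℝ) : ℂ)))) =
        Complex.exp (Complex.I * ((inner ℝ ξ (Φ q.2) : ℝ) : ℂ)) := by
      rw [Complex.star_def, ← Complex.exp_conj]
      simp
    rw [this, Complex.ofReal_sub, show -(Complex.I * (((inner ℝ ξ (Φ q.1) : ℝ) : ℂ) -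
      ((inner ℝ ξ (Φ q.2) : ℝ) : ℂ))) = -(Complex.I * ((inner ℝ ξ (Φ q.1) : ℝ) : ℂ)) +
      Complex.I * ((inner ℝ ξ (Φ q.2) : ℝ) : ℂ) by ring, Complex.exp_add]
    ring
  have hsq : ∀ ξ, fourierPush μ Φ g ξ * star (fourierPush μ Φ g ξ) =
      ∫ q : X × X, g q.1 * star (g q.2) *
        Complex.exp (-(Complex.I * ((inner ℝ ξ (Φ q.1 - Φ q.2) : ℝ) : ℂ))) ∂(μ.prod μ) := by
    intro ξ
    unfold fourierPush
    rw [Complex.star_def, ← integral_conj, ← integral_prod_mul]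
    congr 1
    ext q
    exact hexp ξ q
  simp_rw [hsq, ← integral_const_mul]
  have hG : Integrable (fun ξ : Plane => Complex.exp (-(b : ℂ) * (‖ξ‖ : ℂ) ^ 2)) := by
    have := GaussianFourier.integrable_cexp_neg_mul_sq_norm_add (V := Plane) (b := (b : ℂ))
      (by simpa using hb) 0 0
    simpa using this
  have hGG : Integrable (fun q : X × X => g q.1 * star (g q.2)) (μ.prod μ) :=
    have hs : Integrable (fun p => star (g p)) μ :=
      hi.mono (by fun_prop) (Filter.Eventually.of_forall fun p => by simp)
    hi.mul_prod hs
  rw [integral_integral_swap]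
  · congr 1
    ext q
    rw [← integral_gaussian_mul_exp hb, ← integral_const_mul]
    congr 1
    ext ξ
    ring
  · have hm : Measurable fun z : Plane × (X × X) => inner ℝ z.1 (Φ z.2.1 - Φ z.2.2) :=
      measurable_fst.inner (by fun_prop)
    have := (hG.mul_prod hGG).mul_bdd (c := 1)
      (g := fun z : Plane × (X × X) =>
        Complex.exp (-(Complex.I * ((inner ℝ z.1 (Φ z.2.1 - Φ z.2.2) : ℝ) : ℂ))))
      (by fun_prop) (Filter.Eventually.of_forall fun z => by rw [norm_exp_neg_I_mul])
    refine this.congr (Filter.Eventually.of_forall fun z => ?_)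
    simp only [Function.uncurry]
    ring

/-- A Schur test. The kernel `k` has mass `4π²` for every `b`, so by `hc` its `μ`-integral in either
variable is at most `4π² c`, uniformly in `b`. The leading 2 is the price of `st ≤ s² + t²`. -/
theorem lintegral_gaussian_mul_fourierPush_le (hΦ : Measurable Φ) (hg : Measurable g)
    (hi : Integrable g μ) {c : ℝ≥0∞}
    (hc : ∀ φ : Plane → ℝ≥0∞, Measurable φ → ∫⁻ p, φ (Φ p) ∂μ ≤ c * ∫⁻ v, φ v)
    {b : ℝ} (hb : 0 < b) :
    ∫⁻ ξ : Plane, ENNReal.ofReal (Real.exp (-b * ‖ξ‖ ^ 2)) * ‖fourierPush μ Φ g ξ‖ₑ ^ 2 ≤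
      2 * (c * ENNReal.ofReal (4 * Real.pi ^ 2)) * ∫⁻ p, ‖g p‖ₑ ^ 2 ∂μ := by
  set k : Plane → ℝ≥0∞ := fun v =>
    ENNReal.ofReal (Real.pi / b * Real.exp (-(1 / (4 * b)) * ‖v‖ ^ 2)) with hk
  have hkm : Measurable k := by fun_prop
  have hkint : ∫⁻ v, k v = ENNReal.ofReal (4 * Real.pi ^ 2) := by
    simp_rw [hk, ENNReal.ofReal_mul (show 0 ≤ Real.pi / b by positivity)]
    rw [lintegral_const_mul _ (by fun_prop), lintegral_gaussian (by positivity),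
      ← ENNReal.ofReal_mul (by positivity)]
    congr 1
    field_simp
  have hkl : ∀ x, ∫⁻ q, k (x - Φ q) ∂μ ≤ c * ENNReal.ofReal (4 * Real.pi ^ 2) := by
    intro x
    refine (hc (fun v => k (x - v)) (by fun_prop)).trans (le_of_eq ?_)
    rw [lintegral_sub_left_eq_self, hkint]
  have hkneg : ∀ v w, k (v - w) = k (w - v) := fun v w => by simp only [hk, norm_sub_rev]
  have hgm : Measurable fun p => ‖g p‖ₑ ^ 2 := by fun_prop
  have h1 : ∫⁻ q : X × X, ‖g q.1‖ₑ ^ 2 * k (Φ q.1 - Φ q.2) ∂(μ.prod μ) ≤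
      (c * ENNReal.ofReal (4 * Real.pi ^ 2)) * ∫⁻ p, ‖g p‖ₑ ^ 2 ∂μ := by
    rw [lintegral_prod _ (by fun_prop), ← lintegral_const_mul _ hgm]
    refine lintegral_mono fun p => ?_
    dsimp only
    rw [lintegral_const_mul _ (by fun_prop), mul_comm]
    gcongr
    exact hkl _
  have h2 : ∫⁻ q : X × X, ‖g q.2‖ₑ ^ 2 * k (Φ q.1 - Φ q.2) ∂(μ.prod μ) ≤
      (c * ENNReal.ofReal (4 * Real.pi ^ 2)) * ∫⁻ p, ‖g p‖ₑ ^ 2 ∂μ := by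
    rw [← lintegral_prod_swap]
    simpa only [Prod.fst_swap, Prod.snd_swap, hkneg] using h1
  have hreal : ∀ ξ : Plane, Complex.exp (-(b : ℂ) * (‖ξ‖ : ℂ) ^ 2) *
      (fourierPush μ Φ g ξ * star (fourierPush μ Φ g ξ)) =
      ((Real.exp (-b * ‖ξ‖ ^ 2) * ‖fourierPush μ Φ g ξ‖ ^ 2 : ℝ) : ℂ) := by
    intro ξ
    rw [Complex.star_def, Complex.mul_conj']
    push_cast
    rfl
  have hmain := integral_gaussian_mul_fourierPush hΦ hg hi hb
  simp_rw [hreal] at hmain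
  rw [integral_complex_ofReal] at hmain
  have hFm := measurable_fourierPush (μ := μ) hΦ hg
  have hbd : Integrable fun ξ : Plane =>
      Real.exp (-b * ‖ξ‖ ^ 2) * ‖fourierPush μ Φ g ξ‖ ^ 2 := by
    have hG : Integrable (fun ξ : Plane => Real.exp (-b * ‖ξ‖ ^ 2)) :=
      ⟨by fun_prop, by
        rw [hasFiniteIntegral_iff_ofReal (Filter.Eventually.of_forall fun v => (Real.exp_pos _).le),
          lintegral_gaussian hb]
        exact ENNReal.ofReal_lt_top⟩
    refine hG.mul_bdd (c := (∫⁻ p, ‖g p‖ₑ ∂μ).toReal ^ 2) (by fun_prop)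
      (Filter.Eventually.of_forall fun ξ => ?_)
    rw [norm_pow, norm_norm]
    gcongr
    rw [← toReal_enorm]
    exact ENNReal.toReal_mono hi.2.ne (enorm_fourierPush_le ξ)
  calc ∫⁻ ξ : Plane, ENNReal.ofReal (Real.exp (-b * ‖ξ‖ ^ 2)) * ‖fourierPush μ Φ g ξ‖ₑ ^ 2
      = ∫⁻ ξ : Plane, ENNReal.ofReal (Real.exp (-b * ‖ξ‖ ^ 2) * ‖fourierPush μ Φ g ξ‖ ^ 2) := by
        congr 1
        ext ξ
        rw [ENNReal.ofReal_mul (Real.exp_pos _).le, ENNReal.ofReal_pow (norm_nonneg _),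
          ofReal_norm]
    _ = ENNReal.ofReal (∫ ξ : Plane, Real.exp (-b * ‖ξ‖ ^ 2) * ‖fourierPush μ Φ g ξ‖ ^ 2) :=
        (ofReal_integral_eq_lintegral_ofReal hbd
          (Filter.Eventually.of_forall fun ξ => by positivity)).symm
    _ ≤ ‖((∫ ξ : Plane, Real.exp (-b * ‖ξ‖ ^ 2) * ‖fourierPush μ Φ g ξ‖ ^ 2 : ℝ) : ℂ)‖ₑ := by
        rw [← ofReal_norm, Complex.norm_real]
        exact ENNReal.ofReal_le_ofReal (Real.le_norm_self _)
    _ ≤ ∫⁻ q : X × X, ‖g q.1‖ₑ * ‖g q.2‖ₑ * k (Φ q.1 - Φ q.2) ∂(μ.prod μ) := by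
        rw [hmain]
        refine (enorm_integral_le_lintegral_enorm _).trans (le_of_eq ?_)
        congr 1
        ext q
        rw [enorm_mul, enorm_mul, ← ofReal_norm (star _), norm_star, ofReal_norm, ← ofReal_norm (Complex.ofReal _), Complex.norm_real,
          Real.norm_of_nonneg (by positivity)]
    _ ≤ ∫⁻ q : X × X, (‖g q.1‖ₑ ^ 2 * k (Φ q.1 - Φ q.2) + ‖g q.2‖ₑ ^ 2 * k (Φ q.1 - Φ q.2))
          ∂(μ.prod μ) := by
        refine lintegral_mono fun q => ?_
        dsimp only
        rw [← add_mul]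
        gcongr
        rcases le_total ‖g q.1‖ₑ ‖g q.2‖ₑ with h | h
        · calc _ ≤ ‖g q.2‖ₑ * ‖g q.2‖ₑ := by gcongr
            _ ≤ _ := by rw [← sq]; exact le_add_self
        · calc _ ≤ ‖g q.1‖ₑ * ‖g q.1‖ₑ := by gcongr
            _ ≤ _ := by rw [← sq]; exact le_self_add
    _ ≤ _ := by
        rw [lintegral_add_left (by fun_prop), mul_assoc, two_mul]
        gcongr

/-- The `L²` bound for the Fourier transform of `Φ_*(g μ)` when `Φ_* μ ≤ c vol`. -/
theorem lintegral_fourierPush_sq_le (hΦ : Measurable Φ) (hg : Measurable g)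
    (hi : Integrable g μ) {c : ℝ≥0∞}
    (hc : ∀ φ : Plane → ℝ≥0∞, Measurable φ → ∫⁻ p, φ (Φ p) ∂μ ≤ c * ∫⁻ v, φ v) :
    ∫⁻ ξ : Plane, ‖fourierPush μ Φ g ξ‖ₑ ^ 2 ≤
      2 * (c * ENNReal.ofReal (4 * Real.pi ^ 2)) * ∫⁻ p, ‖g p‖ₑ ^ 2 ∂μ := by
  have hFm := measurable_fourierPush (μ := μ) hΦ hg
  -- The regularisation is removed with `b = 1/(n+1) → 0` and Fatou's lemma, since the bound does
  -- not depend on `b`.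
  set F : ℕ → Plane → ℝ≥0∞ := fun n ξ =>
    ENNReal.ofReal (Real.exp (-(1 / ((n : ℝ) + 1)) * ‖ξ‖ ^ 2)) * ‖fourierPush μ Φ g ξ‖ₑ ^ 2 with hF
  have hlim : ∀ ξ, Filter.Tendsto (fun n => F n ξ) Filter.atTop
      (nhds (‖fourierPush μ Φ g ξ‖ₑ ^ 2)) := by
    intro ξ
    have h1 : Filter.Tendsto (fun n : ℕ => Real.exp (-(1 / ((n : ℝ) + 1)) * ‖ξ‖ ^ 2)) Filter.atTop
        (nhds 1) := by
      have := ((tendsto_one_div_add_atTop_nhds_zero_nat (𝕜 := ℝ)).neg.mul_const (‖ξ‖ ^ 2)).rexp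
      simpa using this
    have h2 := ENNReal.Tendsto.mul_const (b := ‖fourierPush μ Φ g ξ‖ₑ ^ 2)
      (ENNReal.tendsto_ofReal h1) (Or.inl (by simp))
    simpa only [ENNReal.ofReal_one, one_mul] using h2
  calc ∫⁻ ξ : Plane, ‖fourierPush μ Φ g ξ‖ₑ ^ 2
      = ∫⁻ ξ, Filter.liminf (fun n => F n ξ) Filter.atTop := by
        congr 1
        ext ξ
        exact (hlim ξ).liminf_eq.symm
    _ ≤ Filter.liminf (fun n => ∫⁻ ξ, F n ξ) Filter.atTop :=
        lintegral_liminf_le fun n => by fun_prop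
    _ ≤ _ := by
        refine Filter.liminf_le_of_le (by isBoundedDefault) fun a ha => ?_
        obtain ⟨n, hn⟩ := ha.exists
        exact hn.trans (lintegral_gaussian_mul_fourierPush_le hΦ hg hi hc (by positivity))

end

/-! ### Real interpolation: from `L^{3/2}` to `L³` -/

section

variable {X : Type*} [MeasurableSpace X] {μ : Measure X} {Φ : X → Plane} {g : X → ℂ}

/-- The part of `g` exceeding the height `4h²/t²` is small in `L¹`. -/
theorem lintegral_enorm_indicator_le {h t : ℝ} (hh : 0 < h) (ht : 0 < t) :
    ∫⁻ p, ‖{p | ‖g p‖ * t ^ 2 ≤ 4 * h ^ 2}ᶜ.indicator g p‖ₑ ∂μ ≤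
      ENNReal.ofReal (t / (2 * h)) * ∫⁻ p, ‖g p‖ₑ ^ (3 / 2 : ℝ) ∂μ := by
  rw [← lintegral_const_mul' _ _ ENNReal.ofReal_ne_top]
  refine lintegral_mono fun p => ?_
  by_cases hp : ‖g p‖ * t ^ 2 ≤ 4 * h ^ 2
  · rw [Set.indicator_of_notMem (by simpa using hp)]
    simp
  · rw [Set.indicator_of_mem (by simpa using hp), ← ofReal_norm,
      ENNReal.ofReal_rpow_of_nonneg (norm_nonneg _) (by norm_num),
      ← ENNReal.ofReal_mul (by positivity)]
    apply ENNReal.ofReal_le_ofReal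
    push Not at hp
    have hg0 : 0 < ‖g p‖ := by
      by_contra h0
      have : ‖g p‖ = 0 := le_antisymm (not_lt.1 h0) (norm_nonneg _)
      rw [this] at hp
      nlinarith
    -- Above the truncation height `√‖g p‖ · t / (2h)` is at least 1, so inserting it as a factor
    -- only increases `‖g p‖`.
    have hs : 2 * h ≤ Real.sqrt ‖g p‖ * t := by
      apply le_of_sq_le_sq _ (by positivity)
      rw [mul_pow, mul_pow, Real.sq_sqrt hg0.le]
      linarith
    have hpow : ‖g p‖ ^ (3 / 2 : ℝ) = ‖g p‖ * Real.sqrt ‖g p‖ := by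
      rw [Real.sqrt_eq_rpow, ← Real.rpow_one_add' hg0.le (by norm_num)]
      norm_num
    rw [hpow, div_mul_eq_mul_div, le_div_iff₀ (by positivity)]
    nlinarith

/-- For fixed `z` the levels `t` that keep `z` in the truncated part fill an interval of length `2h
/ √‖z‖`. This evaluates the `t`-integral in the layer-cake argument. -/
theorem enorm_sq_mul_volume_le (z : ℂ) {h : ℝ} (hh : 0 ≤ h) :
    ‖z‖ₑ ^ 2 * volume {t : ℝ | 0 < t ∧ ‖z‖ * t ^ 2 ≤ 4 * h ^ 2} ≤
      ENNReal.ofReal (2 * h) * ‖z‖ₑ ^ (3 / 2 : ℝ) := by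
  rcases eq_or_ne z 0 with rfl | hz
  · simp
  have hz0 : 0 < ‖z‖ := norm_pos_iff.2 hz
  have hs0 : 0 < Real.sqrt ‖z‖ := Real.sqrt_pos.2 hz0
  have hsub : {t : ℝ | 0 < t ∧ ‖z‖ * t ^ 2 ≤ 4 * h ^ 2} ⊆ Set.Icc 0 (2 * h / Real.sqrt ‖z‖) := by
    rintro t ⟨ht, h1⟩
    refine ⟨ht.le, ?_⟩
    rw [le_div_iff₀ hs0]
    apply le_of_sq_le_sq _ (by positivity)
    rw [mul_pow, mul_pow, Real.sq_sqrt hz0.le]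
    linarith
  calc _ ≤ ‖z‖ₑ ^ 2 * ENNReal.ofReal (2 * h / Real.sqrt ‖z‖) := by
        gcongr
        exact (measure_mono hsub).trans (by rw [Real.volume_Icc, sub_zero])
    _ = _ := by
        rw [← ofReal_norm, ENNReal.ofReal_rpow_of_nonneg (norm_nonneg _) (by norm_num),
          ← ENNReal.ofReal_pow (norm_nonneg _), ← ENNReal.ofReal_mul (by positivity),
          ← ENNReal.ofReal_mul (by positivity)]
        congr 1
        have hpow : ‖z‖ ^ (3 / 2 : ℝ) = ‖z‖ * Real.sqrt ‖z‖ := by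
          rw [Real.sqrt_eq_rpow, ← Real.rpow_one_add' hz0.le (by norm_num)]
          norm_num
        rw [hpow]
        field_simp
        rw [Real.sq_sqrt hz0.le, mul_comm]

variable [IsFiniteMeasure μ]

/-- The part of `g` above height `4h²/t²` has `L¹` norm at most `t/2`, so its transform never
exceeds `t/2`. On the level set the truncated part must therefore exceed `t/2`, and Chebyshev with
the `L²` bound applies. -/
theorem volume_lt_norm_fourierPush_le (hΦ : Measurable Φ) (hg : Measurable g)
    (hi : Integrable g μ) {c : ℝ≥0∞}
    (hc : ∀ φ : Plane → ℝ≥0∞, Measurable φ → ∫⁻ p, φ (Φ p) ∂μ ≤ c * ∫⁻ v, φ v)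
    {h t : ℝ} (hh : 0 < h) (ht : 0 < t)
    (hH : ∫⁻ p, ‖g p‖ₑ ^ (3 / 2 : ℝ) ∂μ = ENNReal.ofReal h) :
    volume {ξ | t < ‖fourierPush μ Φ g ξ‖} * ENNReal.ofReal (t ^ 2) ≤
      4 * (2 * (c * ENNReal.ofReal (4 * Real.pi ^ 2))) *
        ∫⁻ p, {p | ‖g p‖ * t ^ 2 ≤ 4 * h ^ 2}.indicator (fun p => ‖g p‖ₑ ^ 2) p ∂μ := by
  set S : Set X := {p | ‖g p‖ * t ^ 2 ≤ 4 * h ^ 2} with hS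
  have hSm : MeasurableSet S := measurableSet_le (by fun_prop) (by fun_prop)
  have hsum : S.indicator g + Sᶜ.indicator g = g := Set.indicator_self_add_compl S g
  have hsmall := lintegral_fourierPush_sq_le hΦ (hg.indicator hSm) (hi.indicator hSm) hc
  have hFm := measurable_fourierPush (μ := μ) hΦ (hg.indicator hSm)
  have hsub : {ξ | t < ‖fourierPush μ Φ g ξ‖} ⊆
      {ξ | ENNReal.ofReal ((t / 2) ^ 2) ≤ ‖fourierPush μ Φ (S.indicator g) ξ‖ₑ ^ 2} := by
    intro ξ hξ
    have hξ : t < ‖fourierPush μ Φ g ξ‖ := hξ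
    have hl : ‖fourierPush μ Φ (Sᶜ.indicator g) ξ‖ ≤ t / 2 := by
      rw [← ENNReal.ofReal_le_ofReal_iff (by positivity), ofReal_norm]
      refine (enorm_fourierPush_le ξ).trans ((lintegral_enorm_indicator_le hh ht).trans ?_)
      rw [hH, ← ENNReal.ofReal_mul (by positivity)]
      apply ENNReal.ofReal_le_ofReal
      apply le_of_eq
      field_simp
    have hadd := fourierPush_add hΦ (hi.indicator hSm) (hi.indicator hSm.compl) ξ
    rw [hsum] at hadd
    rw [hadd] at hξ
    have := norm_add_le (fourierPush μ Φ (S.indicator g) ξ) (fourierPush μ Φ (Sᶜ.indicator g) ξ)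
    rw [Set.mem_ofPred_eq, ← ofReal_norm, ← ENNReal.ofReal_pow (norm_nonneg _)]
    apply ENNReal.ofReal_le_ofReal
    gcongr
    linarith
  have hmarkov := mul_meas_ge_le_lintegral₀ (μ := (volume : Measure Plane))
    (f := fun ξ => ‖fourierPush μ Φ (S.indicator g) ξ‖ₑ ^ 2) (by fun_prop)
    (ENNReal.ofReal ((t / 2) ^ 2))
  calc _ ≤ volume {ξ | ENNReal.ofReal ((t / 2) ^ 2) ≤
          ‖fourierPush μ Φ (S.indicator g) ξ‖ₑ ^ 2} * ENNReal.ofReal (t ^ 2) := by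
        gcongr
    _ = 4 * (ENNReal.ofReal ((t / 2) ^ 2) * volume {ξ | ENNReal.ofReal ((t / 2) ^ 2) ≤
          ‖fourierPush μ Φ (S.indicator g) ξ‖ₑ ^ 2}) := by
        rw [show t ^ 2 = 4 * (t / 2) ^ 2 by ring, ENNReal.ofReal_mul (by norm_num)]
        rw [show ENNReal.ofReal 4 = 4 by simp]
        ring
    _ ≤ 4 * (2 * (c * ENNReal.ofReal (4 * Real.pi ^ 2)) *
          ∫⁻ p, ‖S.indicator g p‖ₑ ^ 2 ∂μ) := by
        gcongr 4 * ?_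
        exact hmarkov.trans hsmall
    _ = _ := by
        rw [← mul_assoc]
        congr 2
        ext p
        by_cases hp : p ∈ S <;> simp [hp]

/-- A Hausdorff–Young inequality: the map `g ↦ (Φ_*(g μ))^` is bounded from `L^{3/2}` to `L³`. -/
theorem lintegral_fourierPush_cube_le (hΦ : Measurable Φ) (hg : Measurable g)
    (hi : Integrable g μ) {c : ℝ≥0∞}
    (hc : ∀ φ : Plane → ℝ≥0∞, Measurable φ → ∫⁻ p, φ (Φ p) ∂μ ≤ c * ∫⁻ v, φ v)
    (hH : ∫⁻ p, ‖g p‖ₑ ^ (3 / 2 : ℝ) ∂μ ≠ ∞) :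
    ∫⁻ ξ : Plane, ‖fourierPush μ Φ g ξ‖ₑ ^ (3 : ℝ) ≤
      48 * (c * ENNReal.ofReal (4 * Real.pi ^ 2)) * (∫⁻ p, ‖g p‖ₑ ^ (3 / 2 : ℝ) ∂μ) ^ 2 := by
  set H := ∫⁻ p, ‖g p‖ₑ ^ (3 / 2 : ℝ) ∂μ with hHdef
  -- The truncation height needs `h > 0`.
  rcases eq_or_ne H 0 with h0 | h0
  · rw [hHdef, lintegral_eq_zero_iff (by fun_prop)] at h0
    have hz : ∀ ξ, fourierPush μ Φ g ξ = 0 := by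
      intro ξ
      unfold fourierPush
      apply integral_eq_zero_of_ae
      filter_upwards [h0] with p hp
      have : g p = 0 := by simpa using hp
      simp [this]
    simp [hz]
  set h := H.toReal with hh
  have hpos : 0 < h := ENNReal.toReal_pos h0 hH
  have hHh : H = ENNReal.ofReal h := (ENNReal.ofReal_toReal hH).symm
  set K := 4 * (2 * (c * ENNReal.ofReal (4 * Real.pi ^ 2))) with hK
  have hFm := measurable_fourierPush (μ := μ) hΦ hg
  set S : Set (ℝ × X) := {q | ‖g q.2‖ * q.1 ^ 2 ≤ 4 * h ^ 2} with hS
  have hSm : MeasurableSet S := measurableSet_le (by fun_prop) (by fun_prop)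
  have hGm : Measurable (S.indicator fun q => ‖g q.2‖ₑ ^ 2) := by
    apply Measurable.indicator _ hSm
    fun_prop
  have hlayer := lintegral_rpow_eq_lintegral_meas_lt_mul (volume : Measure Plane)
    (f := fun ξ => ‖fourierPush μ Φ g ξ‖) (Filter.Eventually.of_forall fun ξ => norm_nonneg _)
    (by fun_prop) (p := 3) (by norm_num)
  calc ∫⁻ ξ : Plane, ‖fourierPush μ Φ g ξ‖ₑ ^ (3 : ℝ)
      = ∫⁻ ξ : Plane, ENNReal.ofReal (‖fourierPush μ Φ g ξ‖ ^ (3 : ℝ)) := by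
        congr 1
        ext ξ
        rw [← ofReal_norm, ENNReal.ofReal_rpow_of_nonneg (norm_nonneg _) (by norm_num)]
    _ = 3 * ∫⁻ t in Set.Ioi (0 : ℝ), volume {ξ | t < ‖fourierPush μ Φ g ξ‖} *
          ENNReal.ofReal (t ^ 2) := by
        rw [hlayer]
        norm_num
    _ ≤ 3 * ∫⁻ t in Set.Ioi (0 : ℝ), K * ∫⁻ p, S.indicator (fun q => ‖g q.2‖ₑ ^ 2) (t, p) ∂μ := by
        gcongr 3 * ?_
        refine setLIntegral_mono' measurableSet_Ioi fun t ht => ?_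
        exact volume_lt_norm_fourierPush_le hΦ hg hi hc hpos ht hHh
    -- Tonelli: the truncation depends on `t`, and integrating in `t` first turns `‖g‖²` back into
    -- `‖g‖^{3/2}`.
    _ = 3 * (K * ∫⁻ p, (∫⁻ t in Set.Ioi (0 : ℝ), S.indicator (fun q => ‖g q.2‖ₑ ^ 2) (t, p)) ∂μ) := by
        rw [lintegral_const_mul _ hGm.lintegral_prod_right', lintegral_lintegral_swap]
        exact hGm.aemeasurable
    _ ≤ 3 * (K * ∫⁻ p, ENNReal.ofReal (2 * h) * ‖g p‖ₑ ^ (3 / 2 : ℝ) ∂μ) := by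
        gcongr with p
        refine le_trans (le_of_eq ?_) (enorm_sq_mul_volume_le (g p) hpos.le)
        have hT : MeasurableSet {t : ℝ | 0 < t ∧ ‖g p‖ * t ^ 2 ≤ 4 * h ^ 2} :=
          (measurableSet_Ioi (a := (0 : ℝ))).inter
            (measurableSet_le (f := fun t : ℝ => ‖g p‖ * t ^ 2) (by fun_prop) measurable_const)
        rw [← lintegral_indicator measurableSet_Ioi, ← lintegral_indicator_const hT]
        congr 1
        ext t
        by_cases h1 : 0 < t <;> by_cases h2 : ‖g p‖ * t ^ 2 ≤ 4 * h ^ 2 <;>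
          simp [hS, Set.indicator, h1, h2]
    _ = _ := by
        rw [lintegral_const_mul' _ _ ENNReal.ofReal_ne_top, ← hHdef,
          ENNReal.ofReal_mul zero_le_two, ← hHh, hK]
        rw [show ENNReal.ofReal 2 = 2 by simp]
        ring

end

/-! ### Caps, balls and the cap supremum -/

theorem inner_eq_of_dist (x y : UnitCircle) :
    dist x y ^ 2 = 2 - 2 * inner ℝ (y : Plane) (x : Plane) := by
  rw [dist_sq_eq, PiLp.inner_apply, Fin.sum_univ_two]
  simp

theorem norm_starProjection_sq (z y : UnitCircle) :
    ‖(Submodule.span ℝ {(z : Plane)})ᗮ.starProjection (y : Plane)‖ ^ 2 =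
      1 - inner ℝ (y : Plane) (z : Plane) ^ 2 := by
  have hz : ‖(z : Plane)‖ = 1 := by simp
  have hy : ‖(y : Plane)‖ = 1 := by simp
  rw [Submodule.starProjection_orthogonal_val, Submodule.starProjection_unit_singleton ℝ hz,
    @norm_sub_sq_real, norm_smul, inner_smul_right, hz, hy, real_inner_comm]
  simp
  ring

/-- With `s` the inner product, the squared projection is `1 - s² = d² - (1 - s)² ≤ d²`, where `d`
is the distance. The bound `ρ ≤ 1` forces `s > 1/2`, hence the right hemisphere. -/
theorem ball_subset_cap (x : UnitCircle) {ρ : ℝ} (h1 : ρ ≤ 1) :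
    Metric.ball x ρ ⊆ cap x ρ := by
  intro y hy
  have hy : dist y x < ρ := hy
  rw [dist_comm] at hy
  have hd := inner_eq_of_dist x y
  have hn := norm_starProjection_sq x y
  have h0 : 0 ≤ dist x y := dist_nonneg
  refine ⟨by nlinarith, ?_⟩
  apply lt_of_pow_lt_pow_left₀ 2 (by linarith)
  nlinarith [sq_nonneg (inner ℝ (y : Plane) (x : Plane) - 1)]

/-- In the hemisphere `0 < s ≤ 1`, so `d² = 2(1 - s) ≤ 2(1 - s²) < 2ρ²`. -/
theorem cap_subset_ball (x : UnitCircle) {ρ : ℝ} (h0 : 0 < ρ) :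
    cap x ρ ⊆ Metric.ball x (2 * ρ) := by
  rintro y ⟨h1, h2⟩
  have hd := inner_eq_of_dist x y
  have hn := norm_starProjection_sq x y
  have h3 : ‖(Submodule.span ℝ {(x : Plane)})ᗮ.starProjection (y : Plane)‖ ^ 2 < ρ ^ 2 := by
    gcongr
  rw [Metric.mem_ball, dist_comm]
  apply lt_of_pow_lt_pow_left₀ 2 (by linarith)
  have h4 : inner ℝ (y : Plane) (x : Plane) ≤ 1 := by
    have := sq_nonneg (dist x y)
    linarith
  nlinarith

theorem surfaceMeasure_cap_le (x : UnitCircle) {ρ : ℝ} (h0 : 0 < ρ) :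
    surfaceMeasure (cap x ρ) ≤ ENNReal.ofReal (16 * ρ) := by
  refine (measure_mono (cap_subset_ball x h0)).trans ((surfaceMeasure_ball_le _ _).trans ?_)
  apply ENNReal.ofReal_le_ofReal
  linarith

theorem mem_cap_one {z y : UnitCircle} (h : 0 < inner ℝ (y : Plane) (z : Plane)) :
    y ∈ cap z 1 := by
  refine ⟨h, ?_⟩
  have hn := norm_starProjection_sq z y
  apply lt_of_pow_lt_pow_left₀ 2 zero_le_one
  nlinarith

theorem setLIntegral_cap_le (f : UnitCircle → ℂ) (z : UnitCircle) {r : ℝ}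
    (hr : r ∈ Set.Ioc (0 : ℝ) 1) :
    ∫⁻ x in cap z r, ‖f x‖ₑ ∂surfaceMeasure ≤ capSup f * (4 * ENNReal.ofReal r ^ (1 / 2 : ℝ)) := by
  set s := surfaceMeasure (cap z r) with hs
  have hcap : s ^ (1 / 2 : ℝ) ≤ 4 * ENNReal.ofReal r ^ (1 / 2 : ℝ) := by
    calc s ^ (1 / 2 : ℝ) ≤ ENNReal.ofReal (16 * r) ^ (1 / 2 : ℝ) := by
          gcongr
          exact surfaceMeasure_cap_le z hr.1
      _ = _ := by
          rw [ENNReal.ofReal_mul (by norm_num), ENNReal.mul_rpow_of_nonneg _ _ (by norm_num)]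
          congr 1
          rw [show (16 : ℝ) = 4 ^ (2 : ℝ) by norm_num, ENNReal.ofReal_rpow_of_pos (by positivity),
            ← Real.rpow_mul (by norm_num)]
          norm_num
  -- For a null cap `s ^ (-1/2)` is `∞`, and the powers of `s` would not cancel.
  rcases eq_or_ne s 0 with h0 | h0
  · rw [Measure.restrict_eq_zero.2 h0]
    simp
  have hfin : s ≠ ∞ := measure_ne_top _ _
  have hle : s ^ (-(1 / 2) : ℝ) * ∫⁻ x in cap z r, ‖f x‖ₑ ∂surfaceMeasure ≤ capSup f :=
    le_iSup_of_le z (le_iSup_of_le r (le_iSup_of_le hr le_rfl))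
  calc _ = (s ^ (-(1 / 2) : ℝ) * ∫⁻ x in cap z r, ‖f x‖ₑ ∂surfaceMeasure) * s ^ (1 / 2 : ℝ) := by
        rw [mul_right_comm, ← ENNReal.rpow_add _ _ h0 hfin]
        simp
    _ ≤ _ := by gcongr

/-- Four open half circles, which are caps of radius 1, cover the circle. -/
theorem lintegral_le_capSup (f : UnitCircle → ℂ) :
    ∫⁻ x, ‖f x‖ₑ ∂surfaceMeasure ≤ 16 * capSup f := by
  set e := circlePoint 0
  set e' := circlePoint (Real.pi / 2)
  have hcover : (Set.univ : Set UnitCircle) ⊆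
      (cap e 1 ∪ cap (-e) 1) ∪ (cap e' 1 ∪ cap (-e') 1) := by
    intro y _
    have h0 : inner ℝ (y : Plane) (e : Plane) = (y : Plane) 0 := by
      rw [PiLp.inner_apply, Fin.sum_univ_two]
      simp [e]
    have h1 : inner ℝ (y : Plane) (e' : Plane) = (y : Plane) 1 := by
      rw [PiLp.inner_apply, Fin.sum_univ_two]
      simp [e']
    have hy := y.sq_add_sq
    by_cases c0 : (y : Plane) 0 = 0
    · have c1 : (y : Plane) 1 ≠ 0 := by
        intro h
        simp [c0, h] at hy
      rcases lt_or_gt_of_ne c1 with h | h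
      · refine Or.inr (Or.inr (mem_cap_one ?_))
        rw [coe_neg_sphere, inner_neg_right, h1]
        linarith
      · exact Or.inr (Or.inl (mem_cap_one (by rwa [h1])))
    · rcases lt_or_gt_of_ne c0 with h | h
      · refine Or.inl (Or.inr (mem_cap_one ?_))
        rw [coe_neg_sphere, inner_neg_right, h0]
        linarith
      · exact Or.inl (Or.inl (mem_cap_one (by rwa [h0])))
  have hcap : ∀ z : UnitCircle, ∫⁻ x in cap z 1, ‖f x‖ₑ ∂surfaceMeasure ≤ capSup f * 4 := by
    intro z
    have := setLIntegral_cap_le f z (r := 1) ⟨one_pos, le_rfl⟩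
    simpa using this
  calc ∫⁻ x, ‖f x‖ₑ ∂surfaceMeasure = ∫⁻ x in Set.univ, ‖f x‖ₑ ∂surfaceMeasure := by simp
    _ ≤ ∫⁻ x in (cap e 1 ∪ cap (-e) 1) ∪ (cap e' 1 ∪ cap (-e') 1), ‖f x‖ₑ ∂surfaceMeasure :=
        lintegral_mono_set hcover
    _ ≤ (capSup f * 4 + capSup f * 4) + (capSup f * 4 + capSup f * 4) :=
        (lintegral_union_le _ _ _).trans (add_le_add
          ((lintegral_union_le _ _ _).trans (add_le_add (hcap _) (hcap _)))
          ((lintegral_union_le _ _ _).trans (add_le_add (hcap _) (hcap _))))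
    _ = _ := by ring

/-- Caps control only radii up to 1; beyond that the total mass suffices. The fractional integral
needs all `ρ > 0`. -/
theorem setLIntegral_ball_le_capSup (f : UnitCircle → ℂ) (x : UnitCircle) {ρ : ℝ} (hρ : 0 < ρ) :
    ∫⁻ y in Metric.ball x ρ, ‖f y‖ₑ ∂surfaceMeasure ≤
      16 * capSup f * ENNReal.ofReal ρ ^ (1 / 2 : ℝ) := by
  rcases le_or_gt ρ 1 with h | h
  · calc _ ≤ ∫⁻ y in cap x ρ, ‖f y‖ₑ ∂surfaceMeasure := lintegral_mono_set (ball_subset_cap x h)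
      _ ≤ capSup f * (4 * ENNReal.ofReal ρ ^ (1 / 2 : ℝ)) := setLIntegral_cap_le f x ⟨hρ, h⟩
      _ ≤ capSup f * (16 * ENNReal.ofReal ρ ^ (1 / 2 : ℝ)) := by gcongr; norm_num
      _ = _ := by ring
  · calc _ ≤ ∫⁻ y, ‖f y‖ₑ ∂surfaceMeasure := setLIntegral_le_lintegral _ _
      _ ≤ 16 * capSup f := lintegral_le_capSup f
      _ ≤ _ := by
          apply le_mul_of_one_le_right'
          apply ENNReal.one_le_rpow _ (by norm_num)
          rw [ENNReal.one_le_ofReal]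
          exact h.le

/-- Cauchy–Schwarz for `|f|^{3/2} = |f|^{1/2} · |f|`. This supplies the hypothesis `hball` of
`lintegral_bilinear_le` and carries the gain from the caps. -/
theorem setLIntegral_ball_rpow_le {f : UnitCircle → ℂ} (hf : Measurable f) (x : UnitCircle)
    {ρ : ℝ} (hρ : 0 < ρ) :
    ∫⁻ y in Metric.ball x ρ, ‖f y‖ₑ ^ (3 / 2 : ℝ) ∂surfaceMeasure ≤
      (16 * capSup f) ^ (1 / 2 : ℝ) * eLpNorm f 2 surfaceMeasure *
        ENNReal.ofReal ρ ^ (1 / 4 : ℝ) := by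
  have hCS := ENNReal.lintegral_mul_le_Lp_mul_Lq (surfaceMeasure.restrict (Metric.ball x ρ))
    Real.HolderConjugate.two_two (f := fun y => ‖f y‖ₑ ^ (1 / 2 : ℝ)) (g := fun y => ‖f y‖ₑ)
    (by fun_prop) (by fun_prop)
  have hN : eLpNorm f 2 surfaceMeasure = (∫⁻ y, ‖f y‖ₑ ^ (2 : ℝ) ∂surfaceMeasure) ^ (1 / 2 : ℝ) := by
    rw [eLpNorm_eq_lintegral_rpow_enorm_toReal (by norm_num) (by norm_num)]
    simp
  calc _ = ∫⁻ y in Metric.ball x ρ, ‖f y‖ₑ ^ (1 / 2 : ℝ) * ‖f y‖ₑ ∂surfaceMeasure := by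
        congr 1
        ext y
        rw [show (3 / 2 : ℝ) = 1 / 2 + 1 by norm_num,
          ENNReal.rpow_add_of_nonneg _ _ (by norm_num) (by norm_num), ENNReal.rpow_one]
    _ ≤ (∫⁻ y in Metric.ball x ρ, ‖f y‖ₑ ∂surfaceMeasure) ^ (1 / 2 : ℝ) *
          (∫⁻ y in Metric.ball x ρ, ‖f y‖ₑ ^ (2 : ℝ) ∂surfaceMeasure) ^ (1 / 2 : ℝ) := by
        refine hCS.trans (le_of_eq ?_)
        congr 3
        ext y
        rw [← ENNReal.rpow_mul]
        norm_num
    _ ≤ (16 * capSup f * ENNReal.ofReal ρ ^ (1 / 2 : ℝ)) ^ (1 / 2 : ℝ) *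
          (∫⁻ y, ‖f y‖ₑ ^ (2 : ℝ) ∂surfaceMeasure) ^ (1 / 2 : ℝ) := by
        gcongr
        · exact setLIntegral_ball_le_capSup f x hρ
        · exact Measure.restrict_le_self
    _ = _ := by
        rw [ENNReal.mul_rpow_of_nonneg _ _ (by norm_num), ← ENNReal.rpow_mul, hN]
        norm_num
        ring

/-! ### The fractional integral -/

theorem lintegral_Ioi_rpow {a : ℝ} (ha : a < -1) {D : ℝ} (hD : 0 < D) :
    ∫⁻ ρ in Set.Ioi D, ENNReal.ofReal (ρ ^ a) = ENNReal.ofReal (-D ^ (a + 1) / (a + 1)) := by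
  rw [← integral_Ioi_rpow_of_lt ha hD, ofReal_integral_eq_lintegral_ofReal
    (integrableOn_Ioi_rpow_of_lt ha hD)]
  exact (ae_restrict_mem measurableSet_Ioi).mono fun ρ hρ =>
    Real.rpow_nonneg (hD.trans hρ).le _

theorem lintegral_Ioc_rpow {a : ℝ} (ha : -1 < a) {D : ℝ} (hD : 0 < D) :
    ∫⁻ ρ in Set.Ioc 0 D, ENNReal.ofReal (ρ ^ a) = ENNReal.ofReal (D ^ (a + 1) / (a + 1)) := by
  have h := integral_rpow (a := 0) (b := D) (r := a) (Or.inl ha)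
  rw [Real.zero_rpow (by linarith), sub_zero, intervalIntegral.integral_of_le hD.le] at h
  rw [← h, ofReal_integral_eq_lintegral_ofReal]
  · exact (intervalIntegral.intervalIntegrable_rpow' ha).1
  · exact (ae_restrict_mem measurableSet_Ioc).mono fun ρ hρ => Real.rpow_nonneg hρ.1.le _

/-- The right side equals `2 D^{-1/2}` for `D > 0`. It writes the kernel as a superposition of
indicators of balls; at `D = 0` the left side is `0` by the convention for `rpow`. -/
theorem rpow_neg_half_le_lintegral {D : ℝ} (hD : 0 ≤ D) :
    ENNReal.ofReal (D ^ (-(1 / 2) : ℝ)) ≤ ∫⁻ ρ in Set.Ioi (0 : ℝ),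
      {ρ | D < ρ}.indicator (fun ρ => ENNReal.ofReal (ρ ^ (-(3 / 2) : ℝ))) ρ := by
  rcases hD.eq_or_lt with rfl | hD
  · rw [Real.zero_rpow (by norm_num)]
    simp
  have hI : Set.Ioi D ∩ Set.Ioi 0 = Set.Ioi D :=
    Set.inter_eq_left.2 (Set.Ioi_subset_Ioi hD.le)
  change _ ≤ ∫⁻ ρ in Set.Ioi (0 : ℝ), (Set.Ioi D).indicator _ ρ
  rw [lintegral_indicator measurableSet_Ioi, Measure.restrict_restrict measurableSet_Ioi, hI,
    lintegral_Ioi_rpow (by norm_num) hD]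
  apply ENNReal.ofReal_le_ofReal
  norm_num
  have : 0 ≤ D ^ (-(1 / 2) : ℝ) := Real.rpow_nonneg hD.le _
  norm_num at this
  linarith

/-- The radial bounds that control the truncated fractional integral. -/
theorem lintegral_min_le {a b : ℝ} (ha : 0 < a) (hb : 0 < b) {m : ℝ → ℝ≥0∞}
    (h1 : ∀ ρ, 0 < ρ → m ρ ≤ ENNReal.ofReal (8 * b ^ 3 * ρ))
    (h2 : ∀ ρ, 0 < ρ → m ρ ≤ ENNReal.ofReal (a ^ 3 * ρ ^ (1 / 4 : ℝ))) :
    ∫⁻ ρ in Set.Ioi (0 : ℝ), m ρ * ENNReal.ofReal (ρ ^ (-(3 / 2) : ℝ)) ≤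
      ENNReal.ofReal (20 * a ^ 2 * b) := by
  -- The radius at which `b³ρ` and `a³ρ^{1/4}` balance. The inner range then contributes `16a²b` and
  -- the outer range `4a²b`.
  set δ : ℝ := (a / b) ^ (4 : ℝ) with hδ
  have hδ0 : 0 < δ := by positivity
  have e1 : δ ^ (1 / 2 : ℝ) = (a / b) ^ 2 := by
    rw [hδ, ← Real.rpow_mul (by positivity)]
    norm_num
  have e2 : δ ^ (-(1 / 4) : ℝ) = b / a := by
    rw [hδ, ← Real.rpow_mul (by positivity)]
    norm_num
    rw [Real.rpow_neg_one, inv_div]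
  rw [← Set.Ioc_union_Ioi_eq_Ioi hδ0.le]
  calc _ ≤ (∫⁻ ρ in Set.Ioc 0 δ, m ρ * ENNReal.ofReal (ρ ^ (-(3 / 2) : ℝ))) +
        ∫⁻ ρ in Set.Ioi δ, m ρ * ENNReal.ofReal (ρ ^ (-(3 / 2) : ℝ)) := lintegral_union_le _ _ _
    _ ≤ (∫⁻ ρ in Set.Ioc 0 δ, ENNReal.ofReal (8 * b ^ 3) * ENNReal.ofReal (ρ ^ (-(1 / 2) : ℝ))) +
        ∫⁻ ρ in Set.Ioi δ, ENNReal.ofReal (a ^ 3) * ENNReal.ofReal (ρ ^ (-(5 / 4) : ℝ)) := by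
        apply add_le_add
        · refine setLIntegral_mono' measurableSet_Ioc fun ρ hρ => ?_
          refine (mul_le_mul_left (h1 ρ hρ.1) _).trans (le_of_eq ?_)
          have hρ0 := hρ.1
          rw [← ENNReal.ofReal_mul (by positivity), ← ENNReal.ofReal_mul (by positivity), mul_assoc]
          congr 2
          rw [← Real.rpow_one_add' hρ0.le (by norm_num)]
          norm_num
        · refine setLIntegral_mono' measurableSet_Ioi fun ρ hρ => ?_
          have hρ0 : 0 < ρ := hδ0.trans hρ
          refine (mul_le_mul_left (h2 ρ hρ0) _).trans (le_of_eq ?_)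
          rw [← ENNReal.ofReal_mul (by positivity), ← ENNReal.ofReal_mul (by positivity), mul_assoc]
          congr 2
          rw [← Real.rpow_add hρ0]
          norm_num
    _ = ENNReal.ofReal (16 * a ^ 2 * b) + ENNReal.ofReal (4 * a ^ 2 * b) := by
        rw [lintegral_const_mul' _ _ ENNReal.ofReal_ne_top,
          lintegral_const_mul' _ _ ENNReal.ofReal_ne_top, lintegral_Ioc_rpow (by norm_num) hδ0,
          lintegral_Ioi_rpow (by norm_num) hδ0, ← ENNReal.ofReal_mul (by positivity),
          ← ENNReal.ofReal_mul (by positivity)]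
        rw [show (-(1 / 2) + 1 : ℝ) = 1 / 2 by norm_num,
          show (-(5 / 4) + 1 : ℝ) = -(1 / 4) by norm_num, e1, e2]
        congr 2 <;> field_simp
        norm_num
    _ = _ := by
        rw [← ENNReal.ofReal_add (by positivity) (by positivity)]
        congr 1
        ring

/-- A fractional integral of `u^{3/2}`, truncated to the set where `u ≤ b²`. -/
theorem lintegral_truncated_le {u : UnitCircle → ℝ≥0∞} (hu : Measurable u) {a : ℝ} (ha : 0 < a)
    (hball : ∀ (x : UnitCircle) (ρ : ℝ), 0 < ρ →
      ∫⁻ y in Metric.ball x ρ, u y ^ (3 / 2 : ℝ) ∂surfaceMeasure ≤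
        ENNReal.ofReal (a ^ 3) * ENNReal.ofReal ρ ^ (1 / 4 : ℝ))
    (z : UnitCircle) {b : ℝ} (hb : 0 < b) :
    ∫⁻ y, {y | u y ≤ ENNReal.ofReal (b ^ 2)}.indicator (fun y => u y ^ (3 / 2 : ℝ)) y *
      ENNReal.ofReal (dist z y ^ (-(1 / 2) : ℝ)) ∂surfaceMeasure ≤
      ENNReal.ofReal (20 * a ^ 2 * b) := by
  set F : UnitCircle → ℝ≥0∞ :=
    {y | u y ≤ ENNReal.ofReal (b ^ 2)}.indicator (fun y => u y ^ (3 / 2 : ℝ)) with hF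
  have hFm : Measurable F := (hu.pow_const _).indicator (measurableSet_le hu measurable_const)
  have hFle : ∀ y, F y ≤ u y ^ (3 / 2 : ℝ) :=
    fun y => Set.indicator_apply_le (M := ℝ≥0∞) fun _ => le_rfl
  have hFb : ∀ y, F y ≤ ENNReal.ofReal (b ^ 3) := by
    intro y
    refine Set.indicator_apply_le' (fun hy => ?_) fun _ => zero_le
    calc u y ^ (3 / 2 : ℝ) ≤ ENNReal.ofReal (b ^ 2) ^ (3 / 2 : ℝ) := by
          gcongr
          exact hy
      _ = _ := by
          rw [ENNReal.ofReal_rpow_of_pos (by positivity), ← Real.rpow_natCast b 2,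
            ← Real.rpow_mul hb.le, ← Real.rpow_natCast b 3]
          norm_num
  have hSm : MeasurableSet {q : UnitCircle × ℝ | dist z q.1 < q.2} :=
    measurableSet_lt (by fun_prop) (by fun_prop)
  have hGm : Measurable (({q : UnitCircle × ℝ | dist z q.1 < q.2}).indicator
      fun q => F q.1 * ENNReal.ofReal (q.2 ^ (-(3 / 2) : ℝ))) :=
    Measurable.indicator (by fun_prop) hSm
  calc _ ≤ ∫⁻ y, (∫⁻ ρ in Set.Ioi (0 : ℝ), ({q : UnitCircle × ℝ | dist z q.1 < q.2}).indicator
        (fun q => F q.1 * ENNReal.ofReal (q.2 ^ (-(3 / 2) : ℝ))) (y, ρ)) ∂surfaceMeasure := by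
        refine lintegral_mono fun y => ?_
        have hm : Measurable ({ρ : ℝ | dist z y < ρ}.indicator
            fun ρ => ENNReal.ofReal (ρ ^ (-(3 / 2) : ℝ))) :=
          Measurable.indicator (by fun_prop) measurableSet_Ioi
        refine (mul_le_mul_right (rpow_neg_half_le_lintegral (dist_nonneg (x := z) (y := y))) _).trans
          (le_of_eq ?_)
        rw [← lintegral_const_mul _ hm]
        congr 1
        ext ρ
        by_cases h : dist z y < ρ <;> simp [Set.indicator, h]
    _ = ∫⁻ ρ in Set.Ioi (0 : ℝ), (∫⁻ y, ({q : UnitCircle × ℝ | dist z q.1 < q.2}).indicator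
        (fun q => F q.1 * ENNReal.ofReal (q.2 ^ (-(3 / 2) : ℝ))) (y, ρ) ∂surfaceMeasure) :=
        lintegral_lintegral_swap hGm.aemeasurable
    _ = ∫⁻ ρ in Set.Ioi (0 : ℝ), (∫⁻ y in Metric.ball z ρ, F y ∂surfaceMeasure) *
          ENNReal.ofReal (ρ ^ (-(3 / 2) : ℝ)) := by
        congr 1
        ext ρ
        rw [← lintegral_indicator Metric.isOpen_ball.measurableSet,
          ← lintegral_mul_const' _ _ ENNReal.ofReal_ne_top]
        congr 1
        ext y
        by_cases h : dist z y < ρ <;> simp [Set.indicator, h, dist_comm y z]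
    _ ≤ _ := by
        -- The linear bound comes from the truncation `F ≤ b³` and the length of a ball, the other
        -- from `hball`.
        refine lintegral_min_le ha hb (fun ρ hρ => ?_) fun ρ hρ => ?_
        · calc _ ≤ ∫⁻ y in Metric.ball z ρ, ENNReal.ofReal (b ^ 3) ∂surfaceMeasure :=
                lintegral_mono hFb
            _ ≤ ENNReal.ofReal (b ^ 3) * ENNReal.ofReal (8 * ρ) := by
                rw [setLIntegral_const]
                gcongr
                exact surfaceMeasure_ball_le z ρ
            _ = _ := by
                rw [← ENNReal.ofReal_mul (by positivity)]
                congr 1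
                ring
        · refine (lintegral_mono hFle).trans ((hball z ρ hρ).trans (le_of_eq ?_))
          rw [ENNReal.ofReal_rpow_of_pos hρ, ← ENNReal.ofReal_mul (by positivity)]

/-- The singularities at `y = x` and `y = -x` separate, so the kernel is handled by two applications
of `lintegral_truncated_le`. -/
theorem circleWedge_rpow_le (x y : UnitCircle) :
    circleWedge x y ^ (-(1 / 2) : ℝ) ≤
      2 * (dist x y ^ (-(1 / 2) : ℝ) + dist (-x) y ^ (-(1 / 2) : ℝ)) := by
  have hd := dist_nonneg (x := x) (y := y)
  have hd' := dist_nonneg (x := -x) (y := y)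
  have hw := circleWedge_nonneg x y
  rcases hw.eq_or_lt with h0 | h0
  · rw [← h0, Real.zero_rpow (by norm_num)]
    positivity
  have hp : 0 < dist x y * dist (-x) y := by
    rw [circleWedge_eq] at h0
    linarith
  have h1 : 0 < dist x y := pos_of_mul_pos_left hp hd'
  have h2 : 0 < dist (-x) y := pos_of_mul_pos_right hp hd
  have hmin := min_dist_le_two_mul_circleWedge x y
  have key : ∀ d : ℝ, 0 < d → d ≤ 2 * circleWedge x y →
      circleWedge x y ^ (-(1 / 2) : ℝ) ≤ 2 * d ^ (-(1 / 2) : ℝ) := by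
    intro d hd0 hle
    calc circleWedge x y ^ (-(1 / 2) : ℝ) ≤ (d / 4) ^ (-(1 / 2) : ℝ) :=
          Real.rpow_le_rpow_of_nonpos (by positivity) (by linarith) (by norm_num)
      _ = 2 * d ^ (-(1 / 2) : ℝ) := by
          rw [div_eq_mul_inv, Real.mul_rpow hd0.le (by norm_num), mul_comm]
          congr 1
          rw [Real.inv_rpow (by norm_num), ← Real.rpow_neg (by norm_num),
            show (4 : ℝ) = 2 ^ (2 : ℝ) by norm_num, ← Real.rpow_mul (by norm_num)]
          norm_num
  have p1 : 0 ≤ dist x y ^ (-(1 / 2) : ℝ) := Real.rpow_nonneg hd _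
  have p2 : 0 ≤ dist (-x) y ^ (-(1 / 2) : ℝ) := Real.rpow_nonneg hd' _
  rcases min_choice (dist x y) (dist (-x) y) with h | h <;> rw [h] at hmin
  · linarith [key _ h1 hmin]
  · linarith [key _ h2 hmin]

/-- The bilinear fractional integral with kernel `w^{-1/2}`, where `w` is the wedge. -/
theorem lintegral_bilinear_le {u : UnitCircle → ℝ≥0∞} (hu : Measurable u) (hfin : ∀ x, u x ≠ ∞)
    {a : ℝ} (ha : 0 < a)
    (hball : ∀ (x : UnitCircle) (ρ : ℝ), 0 < ρ →
      ∫⁻ y in Metric.ball x ρ, u y ^ (3 / 2 : ℝ) ∂surfaceMeasure ≤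
        ENNReal.ofReal (a ^ 3) * ENNReal.ofReal ρ ^ (1 / 4 : ℝ)) :
    ∫⁻ p : UnitCircle × UnitCircle, u p.1 ^ (3 / 2 : ℝ) * u p.2 ^ (3 / 2 : ℝ) *
      ENNReal.ofReal (circleWedge p.1 p.2 ^ (-(1 / 2) : ℝ)) ∂(surfaceMeasure.prod surfaceMeasure) ≤
      ENNReal.ofReal (160 * a ^ 2) * ∫⁻ x, u x ^ 2 ∂surfaceMeasure := by
  have hwm : Measurable fun p : UnitCircle × UnitCircle => circleWedge p.1 p.2 :=
    continuous_circleWedge.measurable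
  set G : UnitCircle × UnitCircle → ℝ≥0∞ := fun p => u p.1 ^ (3 / 2 : ℝ) * u p.2 ^ (3 / 2 : ℝ) *
      ENNReal.ofReal (circleWedge p.1 p.2 ^ (-(1 / 2) : ℝ)) with hG
  have hGm : Measurable G := by fun_prop
  have hsymm : ∀ p, G p.swap = G p := by
    intro p
    simp only [hG, Prod.fst_swap, Prod.snd_swap]
    rw [circleWedge_comm, mul_comm (u p.2 ^ _)]
  -- By symmetry it is enough to integrate over the half where `u` is larger at the first point, at
  -- the cost of a factor 2.
  set S : Set (UnitCircle × UnitCircle) := {p | u p.2 ≤ u p.1} with hS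
  have hSm : MeasurableSet S := measurableSet_le (by fun_prop) (by fun_prop)
  have hGS : Measurable (S.indicator G) := hGm.indicator hSm
  have hle : ∀ p, G p ≤ S.indicator G p + S.indicator G p.swap := by
    intro p
    rcases le_total (u p.2) (u p.1) with h | h
    · rw [Set.indicator_of_mem (show p ∈ S from h)]
      exact le_self_add
    · rw [Set.indicator_of_mem (show p.swap ∈ S from h), hsymm]
      exact le_add_self
  have hhalf : ∫⁻ p, S.indicator G p ∂(surfaceMeasure.prod surfaceMeasure) ≤
      ENNReal.ofReal (80 * a ^ 2) * ∫⁻ x, u x ^ 2 ∂surfaceMeasure := by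
    rw [lintegral_prod _ hGS.aemeasurable, ← lintegral_const_mul' _ _ ENNReal.ofReal_ne_top]
    refine lintegral_mono fun x => ?_
    rcases eq_or_ne (u x) 0 with h0 | h0
    · have : ∀ y, S.indicator G (x, y) = 0 := by
        intro y
        refine Set.indicator_apply_eq_zero.2 fun _ => ?_
        simp [hG, h0]
      simp [this]
    -- With this `b` the truncation `u y ≤ b²` is exactly `u y ≤ u x`, and the factor `u x ^ (3/2) =
    -- b³` combines with the inner bound, linear in `b`, into `b⁴ = u x ^ 2`.
    set b : ℝ := Real.sqrt (u x).toReal with hbdef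
    have hb : 0 < b := Real.sqrt_pos.2 (ENNReal.toReal_pos h0 (hfin x))
    have hub : u x = ENNReal.ofReal (b ^ 2) := by
      rw [hbdef, Real.sq_sqrt ENNReal.toReal_nonneg, ENNReal.ofReal_toReal (hfin x)]
    set F : UnitCircle → ℝ≥0∞ :=
      {y | u y ≤ ENNReal.ofReal (b ^ 2)}.indicator (fun y => u y ^ (3 / 2 : ℝ)) with hF
    have hFm : Measurable F := (hu.pow_const _).indicator (measurableSet_le hu measurable_const)
    have hT := fun z => lintegral_truncated_le hu ha hball z hb
    calc ∫⁻ y, S.indicator G (x, y) ∂surfaceMeasure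
        ≤ ∫⁻ y, u x ^ (3 / 2 : ℝ) * (2 * (F y * ENNReal.ofReal (dist x y ^ (-(1 / 2) : ℝ)) +
            F y * ENNReal.ofReal (dist (-x) y ^ (-(1 / 2) : ℝ)))) ∂surfaceMeasure := by
          refine lintegral_mono fun y => ?_
          refine Set.indicator_apply_le' (fun hy => ?_) fun _ => zero_le
          have hy : u y ≤ ENNReal.ofReal (b ^ 2) := hub ▸ hy
          have hFy : F y = u y ^ (3 / 2 : ℝ) :=
            Set.indicator_of_mem (show y ∈ {y | u y ≤ ENNReal.ofReal (b ^ 2)} from hy) _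
          have hw := ENNReal.ofReal_le_ofReal (circleWedge_rpow_le x y)
          rw [ENNReal.ofReal_mul zero_le_two, ENNReal.ofReal_add (by positivity) (by positivity),
            show ENNReal.ofReal 2 = 2 by simp] at hw
          calc G (x, y) ≤ u x ^ (3 / 2 : ℝ) * F y * (2 * (ENNReal.ofReal
                (dist x y ^ (-(1 / 2) : ℝ)) + ENNReal.ofReal (dist (-x) y ^ (-(1 / 2) : ℝ)))) := by
                rw [hFy]
                exact mul_le_mul_right hw _
            _ = _ := by ring
      _ ≤ u x ^ (3 / 2 : ℝ) * (2 * (ENNReal.ofReal (20 * a ^ 2 * b) +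
            ENNReal.ofReal (20 * a ^ 2 * b))) := by
          rw [lintegral_const_mul _ (by fun_prop), lintegral_const_mul _ (by fun_prop),
            lintegral_add_left (by fun_prop)]
          gcongr
          · exact hT x
          · exact hT (-x)
      _ = ENNReal.ofReal (80 * a ^ 2) * u x ^ 2 := by
          have hpow : (b ^ 2) ^ (3 / 2 : ℝ) = b ^ 3 := by
            rw [← Real.rpow_natCast b 2, ← Real.rpow_mul hb.le, ← Real.rpow_natCast b 3]
            norm_num
          rw [hub, ENNReal.ofReal_rpow_of_pos (by positivity), hpow,
            show (2 : ℝ≥0∞) = ENNReal.ofReal 2 by simp, ← ENNReal.ofReal_add (by positivity)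
            (by positivity), ← ENNReal.ofReal_mul (by norm_num), ← ENNReal.ofReal_mul (by positivity),
            ← ENNReal.ofReal_pow (by positivity), ← ENNReal.ofReal_mul (by positivity)]
          congr 1
          ring
  calc _ ≤ ∫⁻ p, (S.indicator G p + S.indicator G p.swap)
        ∂(surfaceMeasure.prod surfaceMeasure) := lintegral_mono hle
    _ = 2 * ∫⁻ p, S.indicator G p ∂(surfaceMeasure.prod surfaceMeasure) := by
        rw [lintegral_add_left hGS, two_mul, lintegral_prod_swap]
    _ ≤ 2 * (ENNReal.ofReal (80 * a ^ 2) * ∫⁻ x, u x ^ 2 ∂surfaceMeasure) := by gcongr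
    _ = _ := by
        rw [← mul_assoc, show 160 * a ^ 2 = 2 * (80 * a ^ 2) by ring,
          ENNReal.ofReal_mul zero_le_two, show ENNReal.ofReal 2 = 2 by simp]

/-! ### The square of the extension as one Fourier transform -/

theorem surfaceMeasure_singleton (x : UnitCircle) : surfaceMeasure {x} = 0 := by
  have hlim : Filter.Tendsto (fun ρ : ℝ => ENNReal.ofReal (8 * ρ)) (nhdsWithin 0 (Set.Ioi 0))
      (nhds 0) := by
    have h : Continuous fun ρ : ℝ => ENNReal.ofReal (8 * ρ) :=
      ENNReal.continuous_ofReal.comp (by fun_prop)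
    have := (h.tendsto 0).mono_left (nhdsWithin_le_nhds (s := Set.Ioi 0))
    simpa using this
  refine le_antisymm (ge_of_tendsto hlim ?_) zero_le
  filter_upwards [self_mem_nhdsWithin] with ρ hρ
  refine (measure_mono ?_).trans (surfaceMeasure_ball_le x ρ)
  rw [Set.singleton_subset_iff]
  exact Metric.mem_ball_self hρ

theorem ae_circleWedge_ne_zero :
    ∀ᵐ p : UnitCircle × UnitCircle ∂(surfaceMeasure.prod surfaceMeasure),
      circleWedge p.1 p.2 ≠ 0 := by
  have hm : MeasurableSet {p : UnitCircle × UnitCircle | circleWedge p.1 p.2 = 0} :=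
    measurableSet_eq_fun continuous_circleWedge.measurable measurable_const
  rw [ae_iff]
  simp only [ne_eq, not_not]
  rw [Measure.measure_prod_null hm]
  refine Filter.Eventually.of_forall fun x => ?_
  have hsub : Prod.mk x ⁻¹' {p : UnitCircle × UnitCircle | circleWedge p.1 p.2 = 0} ⊆
      {x} ∪ {-x} := by
    intro y hy
    have hy : circleWedge x y = 0 := hy
    rw [circleWedge_eq, div_eq_zero_iff, mul_eq_zero] at hy
    rcases hy with (h | h) | h
    · exact Or.inl (dist_eq_zero.1 h).symm
    · exact Or.inr (dist_eq_zero.1 h).symm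
    · norm_num at h
  refine measure_mono_null hsub ?_
  exact measure_union_null (surfaceMeasure_singleton _) (surfaceMeasure_singleton _)

theorem circleWedge_le_one (x y : UnitCircle) : circleWedge x y ≤ 1 := by
  apply abs_le_of_sq_le_sq _ zero_le_one
  have hx := x.sq_add_sq
  have hy := y.sq_add_sq
  have : ((x : Plane) 0 * (y : Plane) 1 - (x : Plane) 1 * (y : Plane) 0) ^ 2 +
      ((x : Plane) 0 * (y : Plane) 0 + (x : Plane) 1 * (y : Plane) 1) ^ 2 = 1 := by
    linear_combination ((y : Plane) 0 ^ 2 + (y : Plane) 1 ^ 2) * hx + hy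
  nlinarith [sq_nonneg ((x : Plane) 0 * (y : Plane) 0 + (x : Plane) 1 * (y : Plane) 1)]

/-- The measure `w(x, y) dσ(x) dσ(y)`, where `w` is the wedge. -/
def wedgeMeasure : Measure (UnitCircle × UnitCircle) :=
  (surfaceMeasure.prod surfaceMeasure).withDensity fun p => ENNReal.ofReal (circleWedge p.1 p.2)

theorem measurable_ofReal_circleWedge :
    Measurable fun p : UnitCircle × UnitCircle => ENNReal.ofReal (circleWedge p.1 p.2) :=
  continuous_circleWedge.measurable.ennreal_ofReal

instance : IsFiniteMeasure wedgeMeasure := by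
  apply isFiniteMeasure_withDensity
  refine ne_top_of_le_ne_top (measure_ne_top (surfaceMeasure.prod surfaceMeasure) Set.univ) ?_
  calc _ ≤ ∫⁻ _, 1 ∂(surfaceMeasure.prod surfaceMeasure) := by
        refine lintegral_mono fun p => ?_
        exact ENNReal.ofReal_le_one.2 (circleWedge_le_one _ _)
    _ = _ := by simp

theorem lintegral_wedgeMeasure {φ : UnitCircle × UnitCircle → ℝ≥0∞} (hφ : Measurable φ) :
    ∫⁻ p, φ p ∂wedgeMeasure = ∫⁻ p, ENNReal.ofReal (circleWedge p.1 p.2) * φ p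
      ∂(surfaceMeasure.prod surfaceMeasure) :=
  lintegral_withDensity_eq_lintegral_mul _ measurable_ofReal_circleWedge hφ

/-- The density of `f σ × f σ` with respect to the wedge measure. -/
def tensorDensity (f : UnitCircle → ℂ) (p : UnitCircle × UnitCircle) : ℂ :=
  f p.1 * f p.2 / (circleWedge p.1 p.2 : ℂ)

theorem measurable_tensorDensity {f : UnitCircle → ℂ} (hf : Measurable f) :
    Measurable (tensorDensity f) := by
  have := continuous_circleWedge.measurable
  unfold tensorDensity
  fun_prop

/-- The product of the two integrals has phase `ξ · (x + y)`, and the weight `w` cancels the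
denominator of `tensorDensity` off the null set `y = ±x`. -/
theorem fourierExtension_sq {f : UnitCircle → ℂ} (ξ : Plane) :
    fourierExtension f ξ ^ 2 = fourierPush wedgeMeasure
      (fun p : UnitCircle × UnitCircle => (p.1 : Plane) + p.2) (tensorDensity f) ξ := by
  unfold fourierPush wedgeMeasure fourierExtension
  rw [integral_withDensity_eq_integral_toReal_smul measurable_ofReal_circleWedge
    (Filter.Eventually.of_forall fun p => ENNReal.ofReal_lt_top), sq, ← integral_prod_mul]
  apply integral_congr_ae
  filter_upwards [ae_circleWedge_ne_zero] with p hp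
  have hp' : (circleWedge p.1 p.2 : ℂ) ≠ 0 := by exact_mod_cast hp
  rw [ENNReal.toReal_ofReal (circleWedge_nonneg p.1 p.2), Complex.real_smul,
    tensorDensity, inner_add_right, Complex.ofReal_add, mul_add, neg_add, Complex.exp_add]
  field_simp

theorem integrable_tensorDensity {f : UnitCircle → ℂ} (hf : Integrable f surfaceMeasure) :
    Integrable (tensorDensity f) wedgeMeasure := by
  unfold wedgeMeasure
  rw [integrable_withDensity_iff_integrable_smul' measurable_ofReal_circleWedge
    (Filter.Eventually.of_forall fun p => ENNReal.ofReal_lt_top)]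
  refine (hf.mul_prod hf).congr ?_
  filter_upwards [ae_circleWedge_ne_zero] with p hp
  have hp' : (circleWedge p.1 p.2 : ℂ) ≠ 0 := by exact_mod_cast hp
  rw [ENNReal.toReal_ofReal (circleWedge_nonneg p.1 p.2), Complex.real_smul,
    tensorDensity]
  field_simp

/-- The power of the wedge is `w · w^{-3/2} = w^{-1/2}`; where `w = 0` the weight kills the left
integrand. -/
theorem lintegral_tensorDensity_le {f : UnitCircle → ℂ} (hf : Measurable f) :
    ∫⁻ p, ‖tensorDensity f p‖ₑ ^ (3 / 2 : ℝ) ∂wedgeMeasure ≤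
      ∫⁻ p : UnitCircle × UnitCircle, ‖f p.1‖ₑ ^ (3 / 2 : ℝ) * ‖f p.2‖ₑ ^ (3 / 2 : ℝ) *
        ENNReal.ofReal (circleWedge p.1 p.2 ^ (-(1 / 2) : ℝ))
        ∂(surfaceMeasure.prod surfaceMeasure) := by
  rw [lintegral_wedgeMeasure ((measurable_tensorDensity hf).enorm.pow_const _)]
  refine lintegral_mono fun p => ?_
  dsimp only
  rcases (circleWedge_nonneg p.1 p.2).eq_or_lt with h | h
  · rw [← h]
    simp
  apply le_of_eq
  set w := circleWedge p.1 p.2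
  have hn : ‖tensorDensity f p‖ₑ = ‖f p.1‖ₑ * ‖f p.2‖ₑ * ENNReal.ofReal w⁻¹ := by
    rw [tensorDensity, div_eq_mul_inv, enorm_mul, enorm_mul, ← Complex.ofReal_inv,
      ← ofReal_norm (Complex.ofReal _), Complex.norm_real, Real.norm_of_nonneg (by positivity)]
  rw [hn, ENNReal.mul_rpow_of_nonneg _ _ (by norm_num), ENNReal.mul_rpow_of_nonneg _ _ (by norm_num),
    mul_left_comm, ENNReal.ofReal_rpow_of_pos (by positivity), ← ENNReal.ofReal_mul h.le]
  congr 2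
  rw [Real.inv_rpow h.le, ← Real.rpow_neg h.le, ← Real.rpow_one_add' h.le (by norm_num)]
  norm_num

/-! ### Assembly of the estimate -/

theorem eLpNorm_two_sq {f : UnitCircle → ℂ} :
    ∫⁻ x, ‖f x‖ₑ ^ 2 ∂surfaceMeasure = eLpNorm f 2 surfaceMeasure ^ 2 := by
  rw [eLpNorm_eq_lintegral_rpow_enorm_toReal (by norm_num) (by norm_num), ← ENNReal.rpow_natCast,
    ← ENNReal.rpow_mul]
  simp

theorem fourierExtension_congr {f f' : UnitCircle → ℂ} (h : f =ᵐ[surfaceMeasure] f') :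
    fourierExtension f = fourierExtension f' := by
  ext ξ
  apply integral_congr_ae
  filter_upwards [h] with x hx
  rw [hx]

theorem capSup_congr {f f' : UnitCircle → ℂ} (h : f =ᵐ[surfaceMeasure] f') :
    capSup f = capSup f' := by
  unfold capSup
  refine iSup_congr fun z => iSup_congr fun r => iSup_congr fun hr => ?_
  congr 1
  apply lintegral_congr_ae
  filter_upwards [ae_restrict_of_ae h] with x hx
  rw [hx]

theorem eLpNorm_fourierExtension_of_ae_eq_zero {f : UnitCircle → ℂ}
    (h : f =ᵐ[surfaceMeasure] 0) :
    eLpNorm (fourierExtension f) 6 (volume : Measure Plane) = 0 := by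
  rw [fourierExtension_congr h]
  have : fourierExtension 0 = 0 := by
    ext ξ
    simp [fourierExtension]
  rw [this]
  simp

theorem lintegral_tensorDensity_le_capSup {f : UnitCircle → ℂ} (hf : Measurable f)
    (hA0 : capSup f ≠ 0) (hA : capSup f ≠ ∞) (hN0 : eLpNorm f 2 surfaceMeasure ≠ 0)
    (hN : eLpNorm f 2 surfaceMeasure ≠ ∞) :
    ∫⁻ p, ‖tensorDensity f p‖ₑ ^ (3 / 2 : ℝ) ∂wedgeMeasure ≤
      160 * ((16 * capSup f) ^ (1 / 2 : ℝ) * eLpNorm f 2 surfaceMeasure) ^ (2 / 3 : ℝ) *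
        eLpNorm f 2 surfaceMeasure ^ 2 := by
  set K := (16 * capSup f) ^ (1 / 2 : ℝ) * eLpNorm f 2 surfaceMeasure with hK
  have hBtop : 16 * capSup f ≠ ∞ := ENNReal.mul_ne_top (by norm_num) hA
  have hB0 : 16 * capSup f ≠ 0 := mul_ne_zero (by norm_num) hA0
  have hKtop : K ≠ ∞ := ENNReal.mul_ne_top (ENNReal.rpow_ne_top_of_nonneg (by norm_num) hBtop) hN
  have hK0 : K ≠ 0 := mul_ne_zero (by simp [hA0, hBtop]) hN0
  have hk : 0 < K.toReal := ENNReal.toReal_pos hK0 hKtop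
  -- The ball hypothesis is normalised with `a³`, so `a` is the cube root of the Cauchy–Schwarz
  -- constant.
  set a : ℝ := K.toReal ^ (1 / 3 : ℝ) with ha
  have ha0 : 0 < a := Real.rpow_pos_of_pos hk _
  have ha3 : ENNReal.ofReal (a ^ 3) = K := by
    rw [ha, ← Real.rpow_natCast, ← Real.rpow_mul hk.le]
    rw [show (1 / 3 * ((3 : ℕ) : ℝ) : ℝ) = 1 by norm_num, Real.rpow_one,
      ENNReal.ofReal_toReal hKtop]
  have ha2 : ENNReal.ofReal (a ^ 2) = K ^ (2 / 3 : ℝ) := by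
    rw [← ha3, ENNReal.ofReal_rpow_of_pos (by positivity), ← Real.rpow_natCast a 3,
      ← Real.rpow_mul ha0.le]
    norm_num
  refine (lintegral_tensorDensity_le hf).trans ?_
  refine (lintegral_bilinear_le hf.enorm (fun x => enorm_ne_top) ha0 fun x ρ hρ => ?_).trans ?_
  · rw [ha3]
    exact setLIntegral_ball_rpow_le hf x hρ
  · rw [ENNReal.ofReal_mul (by norm_num), ha2, eLpNorm_two_sq]
    simp

theorem lintegral_fourierExtension_le {f : UnitCircle → ℂ} (hf : Measurable f)
    (hf2 : MemLp f 2 surfaceMeasure) (hA0 : capSup f ≠ 0) (hA : capSup f ≠ ∞)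
    (hN0 : eLpNorm f 2 surfaceMeasure ≠ 0) :
    ∫⁻ ξ, ‖fourierExtension f ξ‖ₑ ^ (6 : ℝ) ≤
      48 * (2 * ENNReal.ofReal (4 * Real.pi ^ 2)) *
        (160 * ((16 * capSup f) ^ (1 / 2 : ℝ) * eLpNorm f 2 surfaceMeasure) ^ (2 / 3 : ℝ) *
          eLpNorm f 2 surfaceMeasure ^ 2) ^ 2 := by
  have hH := lintegral_tensorDensity_le_capSup hf hA0 hA hN0 hf2.2.ne
  have hBtop : 16 * capSup f ≠ ∞ := ENNReal.mul_ne_top (by norm_num) hA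
  have hHtop : ∫⁻ p, ‖tensorDensity f p‖ₑ ^ (3 / 2 : ℝ) ∂wedgeMeasure ≠ ∞ := by
    refine ne_top_of_le_ne_top ?_ hH
    refine ENNReal.mul_ne_top (ENNReal.mul_ne_top (by norm_num) ?_) (ENNReal.pow_ne_top hf2.2.ne)
    refine ENNReal.rpow_ne_top_of_nonneg (by norm_num) (ENNReal.mul_ne_top ?_ hf2.2.ne)
    exact ENNReal.rpow_ne_top_of_nonneg (by norm_num) hBtop
  have hΦ : Measurable fun p : UnitCircle × UnitCircle => (p.1 : Plane) + p.2 := by fun_prop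
  have hHY := lintegral_fourierPush_cube_le (μ := wedgeMeasure) hΦ (measurable_tensorDensity hf)
    (integrable_tensorDensity (hf2.integrable (by norm_num))) (c := 2)
    (fun φ hφ => by
      rw [lintegral_wedgeMeasure (φ := fun p => φ (p.1 + p.2)) (hφ.comp hΦ)]
      exact lintegral_circleWedge_le hφ) hHtop
  calc ∫⁻ ξ, ‖fourierExtension f ξ‖ₑ ^ (6 : ℝ)
      = ∫⁻ ξ, ‖fourierPush wedgeMeasure (fun p : UnitCircle × UnitCircle => (p.1 : Plane) + p.2)
          (tensorDensity f) ξ‖ₑ ^ (3 : ℝ) := by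
        congr 1
        ext ξ
        rw [← fourierExtension_sq, enorm_pow, ← ENNReal.rpow_natCast, ← ENNReal.rpow_mul]
        norm_num
    _ ≤ _ := hHY.trans (by gcongr)

/-- Exponent count: the cap supremum enters with power `1/2 · 2/3 · 2 = 2/3` and the `L²` norm with
`(2/3 + 2) · 2 = 16/3`; the sixth root gives `1/9` and `8/9`. -/
theorem eLpNorm_fourierExtension_le {f : UnitCircle → ℂ} (hf : Measurable f)
    (hf2 : MemLp f 2 surfaceMeasure) (hA0 : capSup f ≠ 0) (hA : capSup f ≠ ∞)
    (hN0 : eLpNorm f 2 surfaceMeasure ≠ 0) :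
    eLpNorm (fourierExtension f) 6 (volume : Measure Plane) ≤
      (48 * (2 * ENNReal.ofReal (4 * Real.pi ^ 2)) * 160 ^ 2 * 16 ^ (2 / 3 : ℝ)) ^ (1 / 6 : ℝ) *
        (capSup f ^ (1 / 9 : ℝ) * eLpNorm f 2 surfaceMeasure ^ (1 - 1 / 9 : ℝ)) := by
  have h := lintegral_fourierExtension_le hf hf2 hA0 hA hN0
  set N := eLpNorm f 2 surfaceMeasure with hN
  set A := capSup f
  have hNtop : N ≠ ∞ := hf2.2.ne
  rw [eLpNorm_eq_lintegral_rpow_enorm_toReal (by norm_num) (by norm_num)]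
  simp only [ENNReal.toReal_ofNat]
  have hpow : (160 * ((16 * A) ^ (1 / 2 : ℝ) * N) ^ (2 / 3 : ℝ) * N ^ 2) ^ 2 =
      160 ^ 2 * 16 ^ (2 / 3 : ℝ) * (A ^ (2 / 3 : ℝ) * N ^ (16 / 3 : ℝ)) := by
    rw [ENNReal.mul_rpow_of_nonneg _ N (by norm_num), ← ENNReal.rpow_mul,
      ENNReal.mul_rpow_of_nonneg _ _ (by norm_num)]
    simp only [← ENNReal.rpow_natCast]
    rw [ENNReal.mul_rpow_of_nonneg _ _ (by norm_num), ENNReal.mul_rpow_of_nonneg _ _ (by norm_num),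
      ENNReal.mul_rpow_of_nonneg _ _ (by norm_num), ENNReal.mul_rpow_of_nonneg _ _ (by norm_num)]
    simp only [← ENNReal.rpow_mul]
    rw [show (16 / 3 : ℝ) = 2 / 3 * ((2 : ℕ) : ℝ) + ((2 : ℕ) : ℝ) * ((2 : ℕ) : ℝ) by norm_num,
      ENNReal.rpow_add _ _ hN0 hNtop,
      show (1 / 2 * (2 / 3) * ((2 : ℕ) : ℝ) : ℝ) = 2 / 3 by norm_num]
    ring
  calc _ ≤ (48 * (2 * ENNReal.ofReal (4 * Real.pi ^ 2)) *
        (160 ^ 2 * 16 ^ (2 / 3 : ℝ) * (A ^ (2 / 3 : ℝ) * N ^ (16 / 3 : ℝ)))) ^ (1 / 6 : ℝ) := by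
        rw [← hpow]
        gcongr
    _ = _ := by
        rw [← mul_assoc (48 * _) (160 ^ 2 * _) (A ^ _ * _), ← mul_assoc (48 * _) (160 ^ 2) _,
          ENNReal.mul_rpow_of_nonneg _ (A ^ _ * _) (by norm_num),
          ENNReal.mul_rpow_of_nonneg (A ^ _) _ (by norm_num), ← ENNReal.rpow_mul,
          ← ENNReal.rpow_mul]
        norm_num

end

theorem proposition4p1 :
    ∃ α : ℝ, 0 < α ∧ α < 1 ∧ ∃ C : ℝ≥0, ∀ f : UnitCircle → ℂ, MemLp f 2 surfaceMeasure →
      eLpNorm (fourierExtension f) 6 (volume : Measure Plane) ≤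
        (C : ℝ≥0∞) * (capSup f ^ α * eLpNorm f 2 surfaceMeasure ^ (1 - α)) := by
  set C₀ : ℝ≥0∞ :=
    (48 * (2 * ENNReal.ofReal (4 * Real.pi ^ 2)) * 160 ^ 2 * 16 ^ (2 / 3 : ℝ)) ^ (1 / 6 : ℝ) with hC
  have hbase_top : (48 * (2 * ENNReal.ofReal (4 * Real.pi ^ 2)) * 160 ^ 2 *
      16 ^ (2 / 3 : ℝ) : ℝ≥0∞) ≠ ∞ := by
    refine ENNReal.mul_ne_top (ENNReal.mul_ne_top (ENNReal.mul_ne_top (by norm_num)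
      (ENNReal.mul_ne_top (by norm_num) ENNReal.ofReal_ne_top)) (by norm_num)) ?_
    exact ENNReal.rpow_ne_top_of_nonneg (by norm_num) (by norm_num)
  have hbase0 : (48 * (2 * ENNReal.ofReal (4 * Real.pi ^ 2)) * 160 ^ 2 *
      16 ^ (2 / 3 : ℝ) : ℝ≥0∞) ≠ 0 := by
    have h1 : ENNReal.ofReal (4 * Real.pi ^ 2) ≠ 0 := by
      rw [ne_eq, ENNReal.ofReal_eq_zero, not_le]
      positivity
    have h2 : (16 ^ (2 / 3 : ℝ) : ℝ≥0∞) ≠ 0 := by simp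
    exact mul_ne_zero (mul_ne_zero (mul_ne_zero (by norm_num) (mul_ne_zero (by norm_num) h1))
      (by norm_num)) h2
  have hCtop : C₀ ≠ ∞ := ENNReal.rpow_ne_top_of_nonneg (by norm_num) hbase_top
  have hC0 : C₀ ≠ 0 := (ENNReal.rpow_pos (pos_iff_ne_zero.2 hbase0) hbase_top).ne'
  refine ⟨1 / 9, by norm_num, by norm_num, C₀.toNNReal, fun f hf => ?_⟩
  rw [ENNReal.coe_toNNReal hCtop]
  -- Both sides depend only on the a.e. class, so a measurable representative may be used.
  obtain ⟨f', hf', hff'⟩ := hf.1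
  have hm : Measurable f' := hf'.measurable
  have hf2' : MemLp f' 2 surfaceMeasure := hf.ae_eq hff'
  rw [fourierExtension_congr hff', capSup_congr hff', eLpNorm_congr_ae hff']
  rcases eq_or_ne (eLpNorm f' 2 surfaceMeasure) 0 with hN0 | hN0
  · rw [eLpNorm_eq_zero_iff hf2'.1 (by norm_num)] at hN0
    rw [eLpNorm_fourierExtension_of_ae_eq_zero hN0]
    exact zero_le
  -- A vanishing cap supremum forces `f' = 0` a.e., since caps cover the circle.
  rcases eq_or_ne (capSup f') 0 with hA0 | hA0
  · have h := lintegral_le_capSup f'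
    rw [hA0, mul_zero, nonpos_iff_eq_zero, lintegral_eq_zero_iff hm.enorm] at h
    have hz : f' =ᵐ[surfaceMeasure] 0 := by
      filter_upwards [h] with x hx
      simpa using hx
    rw [eLpNorm_fourierExtension_of_ae_eq_zero hz]
    exact zero_le
  -- Here the right side is `∞`, because the constant and the power of the `L²` norm are nonzero;
  -- finiteness of the supremum need not be proved.
  rcases eq_or_ne (capSup f') ∞ with hA | hA
  · have hNpos : eLpNorm f' 2 surfaceMeasure ^ (1 - 1 / 9 : ℝ) ≠ 0 :=
      (ENNReal.rpow_pos (pos_iff_ne_zero.2 hN0) hf2'.2.ne).ne'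
    rw [hA, ENNReal.top_rpow_of_pos (by norm_num), ENNReal.top_mul hNpos, ENNReal.mul_top hC0]
    exact le_top
  exact eLpNorm_fourierExtension_le hm hf2' hA0 hA hN0
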